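/- Let $1\le m\le n$ and let $\beta=dd^c|z|^2$ on $\mathbb C^n$. Let $\Gamma_m$ be the set of real $(1,1)$-forms $\alpha$ on $\mathbb C^n$ with constant coefficients such that $\alpha^k\wedge\beta^{n-k}\ge 0$ for $k=1,\dots,m$. A continuous function $u:\Omega\to\mathbb R$ on an open set $\Omega\subset\mathbb C^n$ is called $m$-subharmonic if $dd^cu\wedge\alpha_1\wedge\dots\wedge\alpha_{m-1}\wedge\beta^{n-m}\ge 0$ in the sense of currents for all $\alpha_1,\dots,\alpha_{m-1}\in\Gamma_m$. For a compact set $X\subset\mathbb C^n$ let $\mathcal{SH}_m^o(X)$ be the set of restrictions to $X$ of functions that are continuous and $m$-subharmonic on some open neighbourhood of $X$. For $z\in X$ let $\mathcal J_z^m(X)$ be the set of regular Borel probability measures $\mu$ on $X$ such that $v(z)\le\int_X v\,d\mu$ for all $v\in\mathcal{SH}_m^o(X)$. Let $\mathcal{SH}_m(X)$ be the set of upper semicontinuous functions $u:X\to[-\infty,\infty)$ such that $u(z)\le\int_X u\,d\mu$ for all $z\in X$ and all $\mu\in\mathcal J_z^m(X)$. Let $\mathcal C(X)$ be the set of continuous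 functions $X\to\mathbb R$. **Theorem 2.7.** Let $X\subset\mathbb C^n$ be a compact set and let $u$ be a real-valued function on $X$. Then $u\in\mathcal{SH}_m(X)\cap\mathcal C(X)$ if and only if each $z\in X$ has a neighbourhood $B_z$ in $\mathbb C^n$ such that $u|_{X\cap\bar B_z}\in\mathcal{SH}_m(X\cap\bar B_z)\cap\mathcal C(X\cap\bar B_z)$. -/

import Mathlib

open MeasureTheory Topology

noncomputable section

namespace MSub

/-- `ℂⁿ` with its Euclidean norm and Lebesgue measure. -/
abbrev Cn (n : ℕ) : Type := EuclideanSpace ℂ (Fin n)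

/-- The vector `c • e_j` of `ℂⁿ`. -/
def dir {n : ℕ} (j : Fin n) (c : ℂ) : Cn n := EuclideanSpace.single j c

/-- The second real derivative of `φ` at `z` in the directions `a`, `b`. -/
def secondDeriv {n : ℕ} (φ : Cn n → ℝ) (z a b : Cn n) : ℝ :=
  fderiv ℝ (fderiv ℝ φ) z a b

/-- The complex Hessian `(∂²φ / ∂z_j ∂z̄_k)_{j,k}` at `z`, with `∂/∂z_j = (∂/∂x_j - i ∂/∂y_j) / 2`
and `∂/∂z̄_k = (∂/∂x_k + i ∂/∂y_k) / 2`. -/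
def complexHessian {n : ℕ} (φ : Cn n → ℝ) (z : Cn n) : Matrix (Fin n) (Fin n) ℂ :=
  fun j k => (1 / 4 : ℂ) *
    (((secondDeriv φ z (dir j 1) (dir k 1)
        + secondDeriv φ z (dir j Complex.I) (dir k Complex.I) : ℝ) : ℂ)
      + Complex.I * ((secondDeriv φ z (dir j 1) (dir k Complex.I)
        - secondDeriv φ z (dir j Complex.I) (dir k 1) : ℝ) : ℂ))

/-- The exterior product of `n` forms of bidegree `(1,1)` on `ℂⁿ`. A matrix `M` stands for the
form `i ∑ M j k dz_j ∧ dz̄_k`, and `wedge M` is the coefficient of `M 0 ∧ ⋯ ∧ M (n-1)` with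
respect to the positive form `(i dz_1 ∧ dz̄_1) ∧ ⋯ ∧ (i dz_n ∧ dz̄_n)`. -/
def wedge {n : ℕ} (M : Fin n → Matrix (Fin n) (Fin n) ℂ) : ℂ :=
  ∑ σ : Equiv.Perm (Fin n), ∑ τ : Equiv.Perm (Fin n),
    (((Equiv.Perm.sign σ : ℤ) * (Equiv.Perm.sign τ : ℤ) : ℤ) : ℂ) * ∏ i, M i (σ i) (τ i)

/-- The cone `Γ_m` of real `(1,1)`-forms `α` with constant coefficients (Hermitian matrices) such
that `α^k ∧ β^(n-k) ≥ 0` for `k = 1, …, m`. The form `β = dd^c |z|²` is represented, up to a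
positive factor, by the identity matrix. -/
def Gamma (n m : ℕ) : Set (Matrix (Fin n) (Fin n) ℂ) :=
  {A | A.IsHermitian ∧ ∀ k : ℕ, 1 ≤ k → k ≤ m →
    0 ≤ (wedge (fun i : Fin n => if (i : ℕ) < k then A else 1)).re}

/-- The coefficient of `H ∧ α_1 ∧ ⋯ ∧ α_{m-1} ∧ β^(n-m)`, where `α_i = A i`; the other values of
`A` are not used. -/
def mWedge {n : ℕ} (m : ℕ) (H : Matrix (Fin n) (Fin n) ℂ)
    (A : ℕ → Matrix (Fin n) (Fin n) ℂ) : ℝ :=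
  (wedge (fun i : Fin n => if (i : ℕ) = 0 then H else if (i : ℕ) < m then A i else 1)).re

/-- `u` is continuous (and real-valued) and `m`-subharmonic on the open set `Ω`: for all
`α_1, …, α_{m-1} ∈ Γ_m` the current `dd^c u ∧ α_1 ∧ ⋯ ∧ α_{m-1} ∧ β^(n-m)` is positive on `Ω`,
that is, `∫ u dd^c φ ∧ α_1 ∧ ⋯ ∧ α_{m-1} ∧ β^(n-m) ≥ 0` for all test functions `φ ≥ 0` on `Ω`.
(The choice `α_i = β` says that the distributional Laplacian of `u` is nonnegative, which for a
continuous `u` means that `u` is subharmonic.) -/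
def ContMSubharmonicOn {n : ℕ} (m : ℕ) (Ω : Set (Cn n)) (u : Cn n → ℝ) : Prop :=
  ContinuousOn u Ω ∧
    ∀ A : ℕ → Matrix (Fin n) (Fin n) ℂ, (∀ i, A i ∈ Gamma n m) →
      ∀ φ : Cn n → ℝ, ContDiff ℝ (⊤ : ℕ∞) φ → HasCompactSupport φ → tsupport φ ⊆ Ω →
        (∀ z, 0 ≤ φ z) → 0 ≤ ∫ z : Cn n, u z * mWedge m (complexHessian φ z) A

/-- `SH_m^o(X)`: functions that agree on `X` with a continuous `m`-subharmonic function on some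
open neighbourhood of `X`. -/
def SHo {n : ℕ} (m : ℕ) (X : Set (Cn n)) : Set (Cn n → ℝ) :=
  {v | ∃ (Ω : Set (Cn n)) (w : Cn n → ℝ), IsOpen Ω ∧ X ⊆ Ω ∧
    ContMSubharmonicOn m Ω w ∧ Set.EqOn v w X}

/-- The Jensen measures on `X` with barycentre `z` with respect to `SH_m^o(X)`. A Borel
probability measure on the compact set `X` is given as one on `ℂⁿ` that is carried by `X`
(regularity is automatic). -/
def JensenMeasures {n : ℕ} (m : ℕ) (X : Set (Cn n)) (z : Cn n) : Set (Measure (Cn n)) :=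
  {μ | IsProbabilityMeasure μ ∧ μ Xᶜ = 0 ∧ ∀ v ∈ SHo m X, v z ≤ ∫ x in X, v x ∂μ}

/-- The integral over `X` of a function with values in `[-∞, ∞)` that is bounded above on `X`,
as the difference of the integrals of the positive and the negative part; it may be `-∞`. -/
def extIntegral {n : ℕ} (μ : Measure (Cn n)) (X : Set (Cn n)) (u : Cn n → EReal) : EReal :=
  ((∫⁻ x in X, (u x).toENNReal ∂μ : ENNReal) : EReal)
    - ((∫⁻ x in X, (-u x).toENNReal ∂μ : ENNReal) : EReal)

/-- `u ∈ SH_m(X)`: `u` is upper semicontinuous on `X` with values in `[-∞, ∞)`, and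
`u(z) ≤ ∫_X u dμ` for all `z ∈ X` and all Jensen measures `μ` with barycentre `z`. -/
def MSubharmonicOnCompact {n : ℕ} (m : ℕ) (X : Set (Cn n)) (u : Cn n → EReal) : Prop :=
  UpperSemicontinuousOn u X ∧ (∀ z ∈ X, u z ≠ ⊤) ∧
    ∀ z ∈ X, ∀ μ ∈ JensenMeasures m X z, u z ≤ extIntegral μ X u

/-- `u ∈ SH_m(X) ∩ C(X)` for a real-valued function `u`; only the restriction of `u` to `X`
matters. -/
def MemSHInterC {n : ℕ} (m : ℕ) (X : Set (Cn n)) (u : Cn n → ℝ) : Prop :=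
  MSubharmonicOnCompact m X (fun z => (u z : EReal)) ∧ ContinuousOn u X

end MSub

end

/-! The forward direction is restriction: a Jensen measure on a smaller compact set is also one on
`X`. For the converse, Edwards' theorem (Hahn–Banach and Riesz) says that a continuous function
obeying the Jensen inequalities on a compact set is a uniform limit there of functions in `SHo`,
because `SHo` is a convex cone containing the constants and stable under maxima. So each `X ∩
closedBall z r` carries an approximant `w z` of `u`. Finitely many of them, corrected by `η (‖x‖² -
‖x - z‖²)`, are glued by taking at `x` the maximum over the centres within distance `r`. The
correction is affine, so it preserves m-subharmonicity, but it penalises distant centres: near a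
point of `X` at distance exactly `r` from a centre, that centre's function is beaten by one whose
centre is closer than `r / 2`. Hence near each point of `X` the maximum runs over a fixed finite
set. The glued function lies in `SHo m X` and is uniformly close to `u`, and Jensen's inequality
passes to the limit (`exists_mem_SHo_of_local_approx`, `memSHInterC_of_locally`).

This requires that continuous m-subharmonic functions are stable under sums and maxima, and that the
notion is local. By Gårding's inequality (`mWedge_nonneg`) the operators in the definition are
positive semidefinite pairings with the complex Hessian, hence sums `∑ ∂²/∂ξ_l²`
(`exists_directions`). They have constant coefficients, so mollification shows that a continuous
function is a weak subsolution exactly when it is a locally uniform limit of smooth ones, for which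
sums and regularized maxima are elementary.

Gårding's inequality comes from hyperbolic polynomials: start from the determinant, differentiate
along directions in the hyperbolicity cone, and use that the cone does not depend on the direction
and only grows under such derivatives. -/

noncomputable section

namespace MSub

/-! ### Hyperbolic forms and their cones -/

section Hyperbolic

set_option linter.unusedSectionVars false

open Polynomial

/-- A complex polynomial of degree `d` without zeros in a closed right half plane is bounded below
there by its leading coefficient. -/
theorem norm_eval_ge_of_ne_zero_rightHalfPlane {P : ℂ[X]} {d : ℕ} {c : ℂ} (hc : c ≠ 0)
    (hd : P.natDegree ≤ d) (hcoeff : P.coeff d = c)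
    (h0 : ∀ t : ℂ, 0 ≤ t.re → P.eval t ≠ 0) {t : ℂ} (ht : 0 ≤ t.re) :
    ‖c‖ * t.re ^ d ≤ ‖P.eval t‖ := by
  have hdeg : P.natDegree = d :=
    le_antisymm hd (le_natDegree_of_ne_zero (by rwa [hcoeff]))
  have hsp : P.Splits := IsAlgClosed.splits P
  have hP0 : P ≠ 0 := by
    rintro rfl; simp at hcoeff; exact hc hcoeff.symm
  rw [hsp.eval_eq_prod_roots, norm_mul, leadingCoeff, hdeg, hcoeff]
  refine mul_le_mul_of_nonneg_left ?_ (norm_nonneg _)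
  have hcard : Multiset.card P.roots = d := by rw [← hdeg, hsp.natDegree_eq_card_roots]
  have hroots : ∀ a ∈ P.roots, a.re < 0 := by
    intro a ha
    by_contra hneg
    exact h0 a (not_lt.mp hneg) ((mem_roots hP0).mp ha)
  rw [← hcard]
  generalize P.roots = s at hroots
  induction s using Multiset.induction_on with
  | empty => simp
  | cons a s ih =>
    simp only [Multiset.card_cons, Multiset.map_cons, Multiset.prod_cons, norm_mul, pow_succ]
    rw [mul_comm]
    have h1 : t.re ≤ ‖t - a‖ := by
      have := Complex.re_le_norm (t - a)
      have h2 := hroots a (Multiset.mem_cons_self a s)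
      simp only [Complex.sub_re] at this
      linarith
    exact mul_le_mul h1 (ih fun b hb => hroots b (Multiset.mem_cons_of_mem hb))
      (by positivity) (norm_nonneg _)

variable {W : Type*} [AddCommGroup W] [Module ℂ W] [TopologicalSpace W] [ContinuousAdd W]
  [ContinuousSMul ℂ W]

/-- A continuous homogeneous complex function of degree `d` which is polynomial along lines and
real on the real form `V` of `W`. -/
structure IsRealForm (V : AddSubgroup W) (d : ℕ) (f : W → ℂ) : Prop where
  smul_mem : ∀ (r : ℝ), ∀ x ∈ V, (r : ℂ) • x ∈ V
  homogeneous : ∀ (c : ℂ) (x : W), f (c • x) = c ^ d * f x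
  im_eq_zero : ∀ x ∈ V, (f x).im = 0
  line : ∀ x a : W, ∃ P : ℂ[X], P.natDegree ≤ d ∧ P.coeff d = f a ∧
    ∀ t : ℂ, P.eval t = f (x + t • a)
  continuous : Continuous f

/-- `f` is hyperbolic in the direction `e`. -/
def IsHyperbolic (V : AddSubgroup W) (f : W → ℂ) (e : W) : Prop :=
  e ∈ V ∧ 0 < (f e).re ∧ ∀ x ∈ V, ∀ t : ℂ, t.im ≠ 0 → f (x + t • e) ≠ 0

/-- The hyperbolicity cone of `f` in the direction `e`. -/
def hyperbolicityCone (V : AddSubgroup W) (f : W → ℂ) (e : W) : Set W :=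
  {x | x ∈ V ∧ ∀ t : ℂ, 0 ≤ t.re → f (x + t • e) ≠ 0}

/-- Absence of zeros is not a closed condition, but this quantitative form of it is; it lets half
planes without zeros survive limits. -/
theorem IsRealForm.norm_ge {V : AddSubgroup W} {d : ℕ} {f : W → ℂ} (hf : IsRealForm V d f)
    {x a : W} (ha : f a ≠ 0) (h0 : ∀ t : ℂ, 0 ≤ t.re → f (x + t • a) ≠ 0) {t : ℂ}
    (ht : 0 ≤ t.re) : ‖f a‖ * t.re ^ d ≤ ‖f (x + t • a)‖ := by
  obtain ⟨P, hP, hc, he⟩ := hf.line x a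
  rw [← he]
  exact norm_eval_ge_of_ne_zero_rightHalfPlane ha hP hc (fun s hs => by rw [he]; exact h0 s hs) ht

/-- Zeros along a path of lines cannot enter a half plane whose boundary they avoid. -/
theorem IsRealForm.ne_zero_of_path {V : AddSubgroup W} {d : ℕ} {f : W → ℂ}
    (hf : IsRealForm V d f) {a : W} (ha : f a ≠ 0) {y : ℝ → W} (hy : Continuous y)
    (hbd : ∀ r ∈ Set.Icc (0 : ℝ) 1, ∀ t : ℂ, t.re = 0 → f (y r + t • a) ≠ 0)
    (hstart : ∀ t : ℂ, 0 ≤ t.re → f (y 0 + t • a) ≠ 0) :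
    ∀ r ∈ Set.Icc (0 : ℝ) 1, ∀ t : ℂ, 0 ≤ t.re → f (y r + t • a) ≠ 0 := by
  set S : Set ℝ := {r | ∀ t : ℂ, 0 ≤ t.re → f (y r + t • a) ≠ 0} with hS
  have hcont : Continuous fun p : ℝ × ℂ => f (y p.1 + p.2 • a) :=
    hf.continuous.comp (by fun_prop)
  -- For `0 < t.re` the lower bound replaces `≠ 0`; on the line `t.re = 0` the hypothesis `hbd`
  -- excludes zeros.
  have hclosed : IsClosed (S ∩ Set.Icc (0 : ℝ) 1) := by
    have : S ∩ Set.Icc (0 : ℝ) 1 = Set.Icc (0 : ℝ) 1 ∩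
        ⋂ t : {t : ℂ // 0 ≤ t.re}, {r | ‖f a‖ * t.1.re ^ d ≤ ‖f (y r + t.1 • a)‖} := by
      ext r
      simp only [Set.mem_inter_iff, Set.mem_iInter, Set.mem_ofPred_eq, Subtype.forall]
      constructor
      · rintro ⟨h1, h2⟩
        exact ⟨h2, fun t ht => hf.norm_ge ha h1 ht⟩
      · rintro ⟨h2, h1⟩
        refine ⟨fun t ht h => ?_, h2⟩
        rcases ht.eq_or_lt with h0 | h0
        · exact hbd r h2 t h0.symm h
        · have := h1 t ht
          rw [h, norm_zero] at this
          have : 0 < ‖f a‖ * t.re ^ d := mul_pos (norm_pos_iff.mpr ha) (pow_pos h0 d)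
          linarith
    rw [this]
    refine isClosed_Icc.inter (isClosed_iInter fun t => isClosed_le continuous_const ?_)
    exact (hcont.comp (by fun_prop : Continuous fun r : ℝ => (r, t.1))).norm
  -- No zeros come in from infinity: by homogeneity, large `t` corresponds to `f (a + s • y r)` with
  -- `s = t⁻¹` near `0`.
  have hfar : ∃ R : ℝ, ∀ r ∈ Set.Icc (0 : ℝ) 1, ∀ t : ℂ, R < ‖t‖ → f (y r + t • a) ≠ 0 := by
    have h1 : ∀ᶠ s : ℂ in 𝓝 0, ∀ r ∈ Set.Icc (0 : ℝ) 1, f (a + s • y r) ≠ 0 := by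
      refine isCompact_Icc.eventually_forall_of_forall_eventually
        (P := fun (s : ℂ) r => f (a + s • y r) ≠ 0) fun r _ => ?_
      have hc : Continuous fun p : ℂ × ℝ => f (a + p.1 • y p.2) :=
        hf.continuous.comp (by fun_prop)
      exact hc.continuousAt.eventually_ne (by simpa using ha)
    obtain ⟨ε, hε, h2⟩ := Metric.eventually_nhds_iff.mp h1
    refine ⟨ε⁻¹, fun r hr t ht h => ?_⟩
    have hpos : 0 < ‖t‖ := lt_trans (inv_pos.mpr hε) ht
    have ht0 : t ≠ 0 := norm_pos_iff.mp hpos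
    have h3 := h2 (y := t⁻¹) (by
      rw [dist_zero_right, norm_inv]
      exact inv_lt_of_inv_lt₀ hε ht) r hr
    apply h3
    have : y r + t • a = t • (a + t⁻¹ • y r) := by
      rw [smul_add, smul_smul, mul_inv_cancel₀ ht0, one_smul, add_comm]
    rw [this, hf.homogeneous] at h
    exact (mul_eq_zero.mp h).resolve_left (pow_ne_zero _ ht0)
  obtain ⟨R, hR⟩ := hfar
  have hK : IsCompact {t : ℂ | 0 ≤ t.re ∧ ‖t‖ ≤ R} := by
    have : {t : ℂ | 0 ≤ t.re ∧ ‖t‖ ≤ R} = {t : ℂ | 0 ≤ t.re} ∩ Metric.closedBall 0 R := by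
      ext; simp
    rw [this]
    exact (isCompact_closedBall _ _).inter_left (isClosed_le continuous_const Complex.continuous_re)
  have hsub : Set.Icc (0 : ℝ) 1 ⊆ S := by
    refine hclosed.Icc_subset_of_forall_mem_nhdsWithin hstart fun x hx => ?_
    -- Tube lemma over the compact half disc; together with `hR` this makes the condition open.
    have h1 : ∀ᶠ r in 𝓝 x, ∀ t ∈ {t : ℂ | 0 ≤ t.re ∧ ‖t‖ ≤ R}, f (y r + t • a) ≠ 0 := by
      refine hK.eventually_forall_of_forall_eventually
        (P := fun r (t : ℂ) => f (y r + t • a) ≠ 0) fun t ht => ?_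
      exact hcont.continuousAt.eventually_ne (hx.1 t ht.1)
    have h2 : ∀ᶠ r in 𝓝[>] x, r ∈ Set.Icc (0 : ℝ) 1 := by
      have : Set.Ioo x 1 ∈ 𝓝[>] x := Ioo_mem_nhdsGT hx.2.2
      filter_upwards [this] with r hr
      exact ⟨hx.2.1.trans hr.1.le, hr.2.le⟩
    filter_upwards [h2, nhdsWithin_le_nhds h1] with r hr h3 t ht
    by_cases hn : ‖t‖ ≤ R
    · exact h3 t ⟨ht, hn⟩
    · exact hR r hr t (not_le.mp hn)
  exact fun r hr => hsub hr

variable {V : AddSubgroup W} {d : ℕ} {f : W → ℂ} {e a b : W}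

theorem IsHyperbolic.ne_zero (h : IsHyperbolic V f e) : f e ≠ 0 := by
  intro h0
  have := h.2.1
  simp [h0] at this

theorem ne_zero_of_mem_hyperbolicityCone (h : a ∈ hyperbolicityCone V f e) : f a ≠ 0 := by
  simpa using h.2 0 le_rfl

/-- For `r > 0` the point is `r` times `b + ((1 - r) / r) • e`, which the cone condition covers. -/
theorem IsRealForm.ne_zero_segment (hf : IsRealForm V d f) (h : IsHyperbolic V f e)
    (hb : b ∈ hyperbolicityCone V f e) {r : ℝ} (hr : r ∈ Set.Icc (0 : ℝ) 1) :
    f (((1 - r : ℝ) : ℂ) • e + (r : ℂ) • b) ≠ 0 := by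
  rcases hr.1.eq_or_lt with h0 | h0
  · simpa [← h0] using h.ne_zero
  · have hr0 : (r : ℂ) ≠ 0 := by exact_mod_cast h0.ne'
    have : ((1 - r : ℝ) : ℂ) • e + (r : ℂ) • b
        = (r : ℂ) • (b + (((1 - r) / r : ℝ) : ℂ) • e) := by
      rw [smul_add, smul_smul, add_comm]
      congr 2
      push_cast
      field_simp
    rw [this, hf.homogeneous]
    refine mul_ne_zero (pow_ne_zero _ hr0) (hb.2 _ ?_)
    rw [Complex.ofReal_re]
    exact div_nonneg (by linarith [hr.2]) h0.le

theorem IsRealForm.segment_mem (hf : IsRealForm V d f) (he : e ∈ V) (hb : b ∈ V) (r s : ℝ) :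
    (r : ℂ) • e + (s : ℂ) • b ∈ V :=
  V.add_mem (hf.smul_mem _ _ he) (hf.smul_mem _ _ hb)

theorem IsRealForm.pos_of_mem_cone (hf : IsRealForm V d f) (h : IsHyperbolic V f e)
    (hb : b ∈ hyperbolicityCone V f e) : 0 < (f b).re := by
  set g : ℝ → ℝ := fun r => (f (((1 - r : ℝ) : ℂ) • e + (r : ℂ) • b)).re with hg
  have hgc : Continuous g := Complex.continuous_re.comp (hf.continuous.comp (by fun_prop))
  have h0 : ∀ r ∈ Set.Icc (0 : ℝ) 1, g r ≠ 0 := by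
    intro r hr h0
    apply hf.ne_zero_segment h hb hr
    apply Complex.ext
    · exact h0
    · exact hf.im_eq_zero _ (hf.segment_mem h.1 hb.1 _ _)
  have hg0 : 0 < g 0 := by simpa [hg] using h.2.1
  have hg1 : g 1 = (f b).re := by simp [hg]
  rw [← hg1]
  by_contra hneg
  obtain ⟨r, hr, hr0⟩ := intermediate_value_Icc' zero_le_one hgc.continuousOn
    ⟨not_lt.mp hneg, hg0.le⟩
  exact h0 r hr hr0

/-- The shift by `iε e` keeps zeros off the boundary while `x` is scaled up from `0`: for purely
imaginary `t` the vector `t • (i a)` is real, so hyperbolicity along `e` applies. At the start `x =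
0`, the cone condition on `a` applies. -/
theorem IsRealForm.ne_zero_of_im_pos (hf : IsRealForm V d f) (h : IsHyperbolic V f e)
    (ha : a ∈ hyperbolicityCone V f e) {x : W} (hx : x ∈ V) {ε : ℝ} (hε : 0 < ε) {t : ℂ}
    (ht : 0 ≤ t.re) : f (x + (ε * Complex.I : ℂ) • e + t • (Complex.I • a)) ≠ 0 := by
  have haI : f (Complex.I • a) ≠ 0 := by
    rw [hf.homogeneous]
    exact mul_ne_zero (pow_ne_zero _ Complex.I_ne_zero) (ne_zero_of_mem_hyperbolicityCone ha)
  have key := hf.ne_zero_of_path haI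
    (y := fun r : ℝ => (r : ℂ) • x + (ε * Complex.I : ℂ) • e) (by fun_prop) ?_ ?_ 1
    (by simp) t ht
  · simpa using key
  · intro r _ t ht0
    have hm : (r : ℂ) • x + ((-t.im : ℝ) : ℂ) • a ∈ V := hf.segment_mem hx ha.1 _ _
    have : (r : ℂ) • x + (ε * Complex.I : ℂ) • e + t • (Complex.I • a)
        = ((r : ℂ) • x + ((-t.im : ℝ) : ℂ) • a) + (ε * Complex.I : ℂ) • e := by
      have h1 : t * Complex.I = ((-t.im : ℝ) : ℂ) := by
        apply Complex.ext <;> simp [ht0]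
      rw [smul_smul, h1]; abel
    rw [this]
    exact h.2.2 _ hm _ (by simpa using hε.ne')
  · intro t ht0
    have hεc : (ε : ℂ) ≠ 0 := by exact_mod_cast hε.ne'
    have h1 : ((0 : ℝ) : ℂ) • x + (ε * Complex.I : ℂ) • e + t • (Complex.I • a)
        = Complex.I • ((ε : ℂ) • e + t • a) := by
      simp only [Complex.ofReal_zero, zero_smul, zero_add, smul_add, smul_smul]
      rw [mul_comm, mul_comm t]
    rw [h1, hf.homogeneous]
    refine mul_ne_zero (pow_ne_zero _ Complex.I_ne_zero) ?_
    by_cases htz : t = 0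
    · rw [htz, zero_smul, add_zero, hf.homogeneous]
      exact mul_ne_zero (pow_ne_zero _ hεc) h.ne_zero
    · have h2 : (ε : ℂ) • e + t • a = t • (a + (ε / t) • e) := by
        rw [smul_add, smul_smul, mul_div_cancel₀ _ htz, add_comm]
      rw [h2, hf.homogeneous]
      refine mul_ne_zero (pow_ne_zero _ htz) (ha.2 _ ?_)
      rw [Complex.div_re]
      simp only [Complex.ofReal_re, Complex.ofReal_im, zero_mul, zero_div, add_zero]
      exact div_nonneg (mul_nonneg hε.le ht0) (Complex.normSq_nonneg _)

/-- A hyperbolic form is hyperbolic in every direction of its hyperbolicity cone. -/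
theorem IsRealForm.isHyperbolic_of_mem_cone (hf : IsRealForm V d f) (h : IsHyperbolic V f e)
    (ha : a ∈ hyperbolicityCone V f e) : IsHyperbolic V f a := by
  refine ⟨ha.1, hf.pos_of_mem_cone h ha, ?_⟩
  have haI : f (Complex.I • a) ≠ 0 := by
    rw [hf.homogeneous]
    exact mul_ne_zero (pow_ne_zero _ Complex.I_ne_zero) (ne_zero_of_mem_hyperbolicityCone ha)
  -- Let `ε → 0`; the uniform lower bound prevents a zero from appearing in the limit. The half
  -- plane `0 < t.re` becomes the upper half plane for the parameter along `a`.
  have hpos : ∀ x ∈ V, ∀ t : ℂ, 0 < t.re → f (x + t • (Complex.I • a)) ≠ 0 := by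
    intro x hx t ht h0
    have hlim : Filter.Tendsto
        (fun ε : ℝ => ‖f (x + (ε * Complex.I : ℂ) • e + t • (Complex.I • a))‖) (𝓝[>] 0)
        (𝓝 ‖f (x + t • (Complex.I • a))‖) := by
      have hc : Continuous fun ε : ℝ => ‖f (x + (ε * Complex.I : ℂ) • e + t • (Complex.I • a))‖ :=
        (hf.continuous.comp (by fun_prop)).norm
      have := hc.tendsto 0
      simp only [Complex.ofReal_zero, zero_mul, zero_smul, add_zero] at this
      exact this.mono_left nhdsWithin_le_nhds
    have hle := ge_of_tendsto hlim (b := ‖f (Complex.I • a)‖ * t.re ^ d) (by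
      filter_upwards [self_mem_nhdsWithin] with ε hε
      exact hf.norm_ge haI (fun s hs => hf.ne_zero_of_im_pos h ha hx hε hs) ht.le)
    rw [h0, norm_zero] at hle
    have : 0 < ‖f (Complex.I • a)‖ * t.re ^ d := mul_pos (norm_pos_iff.mpr haI) (pow_pos ht d)
    linarith
  have hup : ∀ x ∈ V, ∀ t : ℂ, 0 < t.im → f (x + t • a) ≠ 0 := by
    intro x hx t ht
    have := hpos x hx (-Complex.I * t) (by simpa using ht)
    rwa [smul_smul, show -Complex.I * t * Complex.I = t by
      linear_combination (-t) * Complex.I_mul_I] at this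
  intro x hx t ht
  rcases lt_or_gt_of_ne ht with h1 | h1
  · have h2 := hup (-x) (V.neg_mem hx) (-t) (by simpa using h1)
    have : x + t • a = (-1 : ℂ) • (-x + (-t) • a) := by
      simp [smul_add]
    rw [this, hf.homogeneous]
    exact mul_ne_zero (pow_ne_zero _ (by simp)) h2
  · exact hup x hx t h1

/-- The hyperbolicity cone does not depend on the direction. -/
theorem IsRealForm.cone_subset (hf : IsRealForm V d f) (h : IsHyperbolic V f e)
    (ha : a ∈ hyperbolicityCone V f e) :
    hyperbolicityCone V f e ⊆ hyperbolicityCone V f a := by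
  intro b hb
  have hha := hf.isHyperbolic_of_mem_cone h ha
  refine ⟨hb.1, fun t ht => ?_⟩
  -- Move from `e` to `b` along the segment, looking in the direction `a`. Zeros cannot cross the
  -- imaginary axis: off `0` by hyperbolicity along `a`, at `0` by `ne_zero_segment`.
  have key := hf.ne_zero_of_path (ne_zero_of_mem_hyperbolicityCone ha)
    (y := fun r : ℝ => ((1 - r : ℝ) : ℂ) • e + (r : ℂ) • b) (by fun_prop) ?_ ?_ 1
    (by simp) t ht
  · simpa using key
  · intro r hr t ht0
    by_cases him : t.im = 0
    · have : t = 0 := Complex.ext ht0 him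
      rw [this, zero_smul, add_zero]
      exact hf.ne_zero_segment h hb hr
    · exact hha.2.2 _ (hf.segment_mem h.1 hb.1 _ _) t him
  · intro t ht0
    simp only [sub_zero, Complex.ofReal_one, one_smul, Complex.ofReal_zero, zero_smul, add_zero]
    by_cases htz : t = 0
    · simpa [htz] using h.ne_zero
    · have h2 : e + t • a = t • (a + t⁻¹ • e) := by
        rw [smul_add, smul_smul, mul_inv_cancel₀ htz, one_smul, add_comm]
      rw [h2, hf.homogeneous]
      refine mul_ne_zero (pow_ne_zero _ htz) (ha.2 _ ?_)
      rw [Complex.inv_re]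
      exact div_nonneg ht0 (Complex.normSq_nonneg _)

/-- Gauss–Lucas: critical points lie in the convex hull of the zeros. It is used below with the real
line (hyperbolicity) and an open left half plane (cones). -/
theorem derivative_eval_ne_zero {P : ℂ[X]} {d : ℕ} (hd : P.natDegree ≤ d + 1)
    (hc : P.coeff (d + 1) ≠ 0) {S : Set ℂ} (hS : Convex ℝ S)
    (hPS : ∀ t, P.eval t = 0 → t ∈ S) {t : ℂ} (ht : t ∉ S) : P.derivative.eval t ≠ 0 := by
  have hdeg : P.natDegree = d + 1 := le_antisymm hd (le_natDegree_of_ne_zero hc)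
  have hpos : 0 < P.degree := natDegree_pos_iff_degree_pos.mp (by omega)
  have hd0 : P.derivative ≠ 0 := by
    intro h0
    have := derivative_eq_zero.mp h0
    omega
  intro h0
  have hmem : t ∈ P.derivative.rootSet ℂ := by
    rw [mem_rootSet]; exact ⟨hd0, by simpa using h0⟩
  refine ht (convexHull_min ?_ hS (rootSet_derivative_subset_convexHull_rootSet hpos hmem))
  intro s hs
  rw [mem_rootSet] at hs
  exact hPS s (by simpa using hs.2)

theorem IsRealForm.derivative_ne_zero (hf : IsRealForm V (d + 1) f) {g : W → ℂ} {x : W}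
    (hg : ∀ t : ℂ, HasDerivAt (fun t : ℂ => f (x + t • a)) ((d + 1) * g (x + t • a)) t)
    (ha : f a ≠ 0) {S : Set ℂ} (hS : Convex ℝ S) (hfS : ∀ t, t ∉ S → f (x + t • a) ≠ 0) {t : ℂ}
    (ht : t ∉ S) : g (x + t • a) ≠ 0 := by
  obtain ⟨P, hP, hc, he⟩ := hf.line x a
  have h1 := derivative_eval_ne_zero hP (by rwa [hc]) hS
    (fun t h0 => by_contra fun hn => hfS t hn (by rw [← he, h0])) ht
  have h2 := P.hasDerivAt t
  have h3 : (fun t => P.eval t) = fun t : ℂ => f (x + t • a) := funext he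
  rw [h3] at h2
  rw [h2.unique (hg t)] at h1
  exact right_ne_zero_of_mul h1

/-- The derivative of a hyperbolic form in the direction `a` is hyperbolic in that direction. -/
theorem IsRealForm.isHyperbolic_derivative (hf : IsRealForm V (d + 1) f) {g : W → ℂ}
    (hg : ∀ (x : W) (t : ℂ),
      HasDerivAt (fun t : ℂ => f (x + t • a)) ((d + 1) * g (x + t • a)) t)
    (hga : g a = f a) (h : IsHyperbolic V f a) : IsHyperbolic V g a := by
  refine ⟨h.1, hga ▸ h.2.1, fun x hx t ht => ?_⟩
  refine hf.derivative_ne_zero (hg x) h.ne_zero (S := {z | z.im = 0}) ?_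
    (fun s hs => h.2.2 x hx s hs) ht
  exact (convex_singleton (0 : ℝ)).linear_preimage Complex.imLm

theorem IsRealForm.cone_subset_derivative (hf : IsRealForm V (d + 1) f) {g : W → ℂ}
    (hg : ∀ (x : W) (t : ℂ),
      HasDerivAt (fun t : ℂ => f (x + t • a)) ((d + 1) * g (x + t • a)) t)
    (h : IsHyperbolic V f a) : hyperbolicityCone V f a ⊆ hyperbolicityCone V g a := by
  intro x hx
  refine ⟨hx.1, fun t ht => ?_⟩
  refine hf.derivative_ne_zero (hg x) h.ne_zero (S := {z | z.re < 0}) ?_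
    (fun s hs => hx.2 s (not_lt.mp hs)) (not_lt.mpr ht)
  exact (convex_Iio (0 : ℝ)).linear_preimage Complex.reLm

end Hyperbolic

/-! ### Mixed exterior products and Gårding's inequality -/

section Wedge

open Polynomial
open scoped ComplexOrder

variable {n : ℕ}

theorem wedge_comp_perm (M : Fin n → Matrix (Fin n) (Fin n) ℂ) (π : Equiv.Perm (Fin n)) :
    wedge (fun i => M (π i)) = wedge M := by
  unfold wedge
  refine (Fintype.sum_equiv (Equiv.mulRight π) _ _ fun σ =>
    Fintype.sum_equiv (Equiv.mulRight π) _ _ fun τ => ?_).symm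
  have h1 : ∏ i, M (π i) ((σ * π) i) ((τ * π) i) = ∏ i, M i (σ i) (τ i) :=
    Equiv.prod_comp π fun i => M i (σ i) (τ i)
  have h2 : ((Equiv.Perm.sign π : ℤ) : ℂ) * ((Equiv.Perm.sign π : ℤ) : ℂ) = 1 := by
    rw [← Int.cast_mul]
    rcases Int.units_eq_one_or (Equiv.Perm.sign π) with h | h <;> simp [h]
  simp only [Equiv.coe_mulRight, Equiv.Perm.sign_mul, Units.val_mul, Int.cast_mul, h1]
  linear_combination (-((Equiv.Perm.sign σ : ℤ) : ℂ) * ((Equiv.Perm.sign τ : ℤ) : ℂ) *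
    ∏ i, M i (σ i) (τ i)) * h2

theorem wedge_conjTranspose (M : Fin n → Matrix (Fin n) (Fin n) ℂ) :
    wedge (fun i => (M i).conjTranspose) = (starRingEnd ℂ) (wedge M) := by
  unfold wedge
  simp only [map_sum]
  rw [Finset.sum_comm]
  refine Finset.sum_congr rfl fun σ _ => Finset.sum_congr rfl fun τ _ => ?_
  rw [map_mul, map_prod, map_intCast, mul_comm ((Equiv.Perm.sign σ : ℤ))]
  rfl

theorem wedge_im_eq_zero {M : Fin n → Matrix (Fin n) (Fin n) ℂ} (hM : ∀ i, (M i).IsHermitian) :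
    (wedge M).im = 0 := by
  rw [← Complex.conj_eq_iff_im, ← wedge_conjTranspose]
  exact congrArg wedge (funext hM)

theorem wedge_const (A : Matrix (Fin n) (Fin n) ℂ) :
    wedge (fun _ => A) = (n.factorial : ℂ) * A.det := by
  unfold wedge
  have h : ∀ σ : Equiv.Perm (Fin n), ∑ τ : Equiv.Perm (Fin n),
      (((Equiv.Perm.sign σ : ℤ) * (Equiv.Perm.sign τ : ℤ) : ℤ) : ℂ) * ∏ i, A (σ i) (τ i)
        = A.det := by
    intro σ
    rw [← Matrix.det_transpose, Matrix.det_apply']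
    refine (Fintype.sum_equiv (Equiv.mulRight σ) _ _ fun τ => ?_).symm
    have h1 : ∏ i, A (σ i) (τ (σ i)) = ∏ i, A i (τ i) := Equiv.prod_comp σ fun i => A i (τ i)
    have h2 : ((Equiv.Perm.sign σ : ℤ) : ℂ) * ((Equiv.Perm.sign σ : ℤ) : ℂ) = 1 := by
      rw [← Int.cast_mul]
      rcases Int.units_eq_one_or (Equiv.Perm.sign σ) with h | h <;> simp [h]
    simp only [Equiv.coe_mulRight, Equiv.Perm.sign_mul, Units.val_mul, Int.cast_mul,
      Equiv.Perm.coe_mul, Function.comp_apply, h1, Matrix.transpose_apply]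
    linear_combination (-((Equiv.Perm.sign τ : ℤ) : ℂ) * ∏ i, A i (τ i)) * h2
  rw [Finset.sum_congr rfl fun σ _ => h σ]
  simp [Fintype.card_perm]

theorem wedge_eq_zero {M : Fin n → Matrix (Fin n) (Fin n) ℂ} {i : Fin n} (h : M i = 0) :
    wedge M = 0 := by
  unfold wedge
  refine Finset.sum_eq_zero fun σ _ => Finset.sum_eq_zero fun τ _ => ?_
  rw [Finset.prod_eq_zero (Finset.mem_univ i) (by simp [h]), mul_zero]

theorem continuous_wedge : Continuous (wedge : (Fin n → Matrix (Fin n) (Fin n) ℂ) → ℂ) := by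
  unfold wedge
  fun_prop

theorem hasDerivAt_wedge {M : ℂ → Fin n → Matrix (Fin n) (Fin n) ℂ}
    {D : Fin n → Matrix (Fin n) (Fin n) ℂ} {t : ℂ}
    (h : ∀ i j k, HasDerivAt (fun s => M s i j k) (D i j k) t) :
    HasDerivAt (fun s => wedge (M s)) (∑ i, wedge (Function.update (M t) i (D i))) t := by
  unfold wedge
  rw [Finset.sum_comm]
  refine HasDerivAt.fun_sum fun σ _ => ?_
  rw [Finset.sum_comm]
  refine HasDerivAt.fun_sum fun τ _ => ?_
  rw [← Finset.mul_sum]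
  refine HasDerivAt.const_mul _ ?_
  refine (HasDerivAt.fun_finsetProd fun i _ => h i (σ i) (τ i)).congr_deriv ?_
  refine Finset.sum_congr rfl fun i _ => ?_
  rw [← Finset.prod_erase_mul _ _ (Finset.mem_univ i), smul_eq_mul, Function.update_self]
  congr 1
  refine Finset.prod_congr rfl fun j hj => ?_
  rw [Function.update_of_ne (Finset.ne_of_mem_erase hj)]

/-- The form `x ↦ x ∧ ⋯ ∧ x ∧ B_j ∧ ⋯ ∧ B_{n-1}` with `j` factors `x`. -/
def partialWedge (B : Fin n → Matrix (Fin n) (Fin n) ℂ) (j : ℕ)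
    (x : Matrix (Fin n) (Fin n) ℂ) : ℂ :=
  wedge fun i => if (i : ℕ) < j then x else B i

/-- The additive group of Hermitian matrices. -/
abbrev hermitian (n : ℕ) : AddSubgroup (Matrix (Fin n) (Fin n) ℂ) :=
  selfAdjoint (Matrix (Fin n) (Fin n) ℂ)

theorem natDegree_prod_le_and_coeff {ι : Type*} (s : Finset ι) (f : ι → ℂ[X]) (d : ι → ℕ)
    (h : ∀ i ∈ s, (f i).natDegree ≤ d i) :
    (∏ i ∈ s, f i).natDegree ≤ ∑ i ∈ s, d i ∧
      (∏ i ∈ s, f i).coeff (∑ i ∈ s, d i) = ∏ i ∈ s, (f i).coeff (d i) := by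
  classical
  induction s using Finset.induction_on with
  | empty => simp
  | insert a s ha ih =>
    obtain ⟨h1, h2⟩ := ih fun i hi => h i (Finset.mem_insert_of_mem hi)
    have h3 := h a (Finset.mem_insert_self a s)
    simp only [Finset.prod_insert ha, Finset.sum_insert ha]
    exact ⟨natDegree_mul_le_of_le h3 h1, by rw [coeff_mul_add_eq_of_natDegree_le h3 h1, h2]⟩

theorem card_filter_lt {j : ℕ} (hj : j ≤ n) :
    (Finset.univ.filter fun i : Fin n => (i : ℕ) < j).card = j := by
  simp [Fin.card_filter_val_lt, hj]

/-- Each of the `j` slots holding `x + t • a` contributes one linear factor; the coefficient of `t ^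
j` picks `a` in all of them. -/
theorem partialWedge_line (B : Fin n → Matrix (Fin n) (Fin n) ℂ) {j : ℕ} (hj : j ≤ n)
    (x a : Matrix (Fin n) (Fin n) ℂ) :
    ∃ P : ℂ[X], P.natDegree ≤ j ∧ P.coeff j = partialWedge B j a ∧
      ∀ t : ℂ, P.eval t = partialWedge B j (x + t • a) := by
  set d : Fin n → ℕ := fun i => if (i : ℕ) < j then 1 else 0 with hd
  have hsum : ∑ i, d i = j := by
    rw [hd, Finset.sum_boole, card_filter_lt hj, Nat.cast_id]
  set q : Fin n → Fin n → Fin n → ℂ[X] := fun i k l =>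
    if (i : ℕ) < j then C (a k l) * X + C (x k l) else C (B i k l) with hq
  have hqd : ∀ i k l, (q i k l).natDegree ≤ d i := by
    intro i k l
    simp only [hq, hd]
    split_ifs
    · exact natDegree_linear_le
    · exact natDegree_C _ |>.le
  have hprod := fun σ τ : Equiv.Perm (Fin n) =>
    natDegree_prod_le_and_coeff Finset.univ (fun i => q i (σ i) (τ i)) d fun i _ => hqd _ _ _
  simp only [hsum] at hprod
  refine ⟨∑ σ : Equiv.Perm (Fin n), ∑ τ : Equiv.Perm (Fin n),
    C (((Equiv.Perm.sign σ : ℤ) * (Equiv.Perm.sign τ : ℤ) : ℤ) : ℂ) * ∏ i, q i (σ i) (τ i),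
    ?_, ?_, fun t => ?_⟩
  · exact natDegree_sum_le_of_forall_le _ _ fun σ _ =>
      natDegree_sum_le_of_forall_le _ _ fun τ _ =>
        (natDegree_C_mul_le _ _).trans (hprod σ τ).1
  · simp only [finsetSum_coeff, coeff_C_mul, (hprod _ _).2]
    unfold partialWedge wedge
    refine Finset.sum_congr rfl fun σ _ => Finset.sum_congr rfl fun τ _ => ?_
    congr 1
    refine Finset.prod_congr rfl fun i _ => ?_
    simp only [hq, hd]
    split_ifs <;> simp
  · simp only [eval_finsetSum, eval_mul, eval_C, eval_prod]
    unfold partialWedge wedge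
    refine Finset.sum_congr rfl fun σ _ => Finset.sum_congr rfl fun τ _ => ?_
    congr 1
    refine Finset.prod_congr rfl fun i _ => ?_
    simp only [hq]
    split_ifs
    · simp only [eval_add, eval_mul, eval_C, eval_X, Matrix.add_apply, Matrix.smul_apply,
        smul_eq_mul]
      ring
    · simp

theorem partialWedge_smul (B : Fin n → Matrix (Fin n) (Fin n) ℂ) {j : ℕ} (hj : j ≤ n)
    (c : ℂ) (x : Matrix (Fin n) (Fin n) ℂ) :
    partialWedge B j (c • x) = c ^ j * partialWedge B j x := by
  unfold partialWedge wedge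
  simp only [Finset.mul_sum]
  refine Finset.sum_congr rfl fun σ _ => Finset.sum_congr rfl fun τ _ => ?_
  have h : ∏ i : Fin n, (if (i : ℕ) < j then c else 1) = c ^ j := by
    rw [Finset.prod_ite, Finset.prod_const, Finset.prod_const_one, mul_one, card_filter_lt hj]
  rw [mul_left_comm, ← h, ← Finset.prod_mul_distrib]
  congr 1
  refine Finset.prod_congr rfl fun i _ => ?_
  split_ifs <;> simp

theorem isRealForm_partialWedge {B : Fin n → Matrix (Fin n) (Fin n) ℂ}
    (hB : ∀ i, (B i).IsHermitian) {j : ℕ} (hj : j ≤ n) :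
    IsRealForm (hermitian n) j (partialWedge B j) where
  smul_mem r x hx := by
    rw [selfAdjoint.mem_iff] at hx ⊢
    rw [star_smul, hx, ← Complex.conj_ofReal r]
    simp
  homogeneous := partialWedge_smul B hj
  im_eq_zero x hx := by
    refine wedge_im_eq_zero fun i => ?_
    split_ifs
    · exact hx
    · exact hB i
  line := partialWedge_line B hj
  continuous := by
    unfold partialWedge
    refine continuous_wedge.comp (continuous_pi fun i => ?_)
    split_ifs <;> fun_prop

/-- The product rule gives `j + 1` terms, each with `B j` in one slot; symmetry of `wedge` moves it
to slot `j`, so all are equal. Differentiating along `B j` thus lowers the degree of the form by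
one. -/
theorem hasDerivAt_partialWedge (B : Fin n → Matrix (Fin n) (Fin n) ℂ) {j : ℕ} (hj : j < n)
    (x : Matrix (Fin n) (Fin n) ℂ) (t : ℂ) :
    HasDerivAt (fun t : ℂ => partialWedge B (j + 1) (x + t • B ⟨j, hj⟩))
      ((j + 1) * partialWedge B j (x + t • B ⟨j, hj⟩)) t := by
  set a := B ⟨j, hj⟩ with ha
  unfold partialWedge
  refine (hasDerivAt_wedge (M := fun s i => if (i : ℕ) < j + 1 then x + s • a else B i)
    (D := fun i => if (i : ℕ) < j + 1 then a else 0) fun i k l => ?_).congr_deriv ?_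
  · split_ifs
    · simpa using ((hasDerivAt_id t).mul_const (a k l)).const_add (x k l)
    · exact hasDerivAt_const _ _
  · have hterm : ∀ i : Fin n, wedge (Function.update
        (fun i : Fin n => if (i : ℕ) < j + 1 then x + t • a else B i) i
          (if (i : ℕ) < j + 1 then a else 0)) = if (i : ℕ) < j + 1 then
        wedge (fun i : Fin n => if (i : ℕ) < j then x + t • a else B i) else 0 := by
      intro i
      split_ifs with hi
      · rw [← wedge_comp_perm _ (Equiv.swap i ⟨j, hj⟩)]
        congr 1
        funext k
        by_cases hkj : k = ⟨j, hj⟩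
        · rw [hkj, Equiv.swap_apply_right, Function.update_self]
          simp [ha]
        by_cases hki : k = i
        · have hij : (i : ℕ) < j := by
            have : (i : ℕ) ≠ j := fun h => hkj (hki.trans (Fin.ext h))
            omega
          rw [hki, Equiv.swap_apply_left, Function.update_of_ne fun h => hkj (hki.trans h.symm)]
          simp [hij]
        · rw [Equiv.swap_apply_of_ne_of_ne hki hkj, Function.update_of_ne hki]
          have h1 : (k : ℕ) ≠ j := fun h => hkj (Fin.ext h)
          have h2 : (k : ℕ) < j + 1 ↔ (k : ℕ) < j := by omega
          simp only [h2]
      · exact wedge_eq_zero (i := i) (by simp)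
    rw [Finset.sum_congr rfl fun i _ => hterm i, ← Finset.sum_filter, Finset.sum_const,
      card_filter_lt (Nat.succ_le_of_lt hj), nsmul_eq_mul]
    push_cast
    rfl

theorem partialWedge_succ_self (B : Fin n → Matrix (Fin n) (Fin n) ℂ) {j : ℕ} (hj : j < n) :
    partialWedge B j (B ⟨j, hj⟩) = partialWedge B (j + 1) (B ⟨j, hj⟩) := by
  unfold partialWedge
  congr 1
  funext i
  rcases lt_trichotomy (i : ℕ) j with h | h | h
  · simp [h, h.trans (Nat.lt_succ_self j)]
  · have : i = ⟨j, hj⟩ := Fin.ext h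
    simp [this]
  · simp [h.not_gt, show ¬ (i : ℕ) < j + 1 by omega]

theorem isHyperbolic_partialWedge_pred {B : Fin n → Matrix (Fin n) (Fin n) ℂ}
    (hB : ∀ i, (B i).IsHermitian) {j : ℕ} (hj : j < n)
    (h : IsHyperbolic (hermitian n) (partialWedge B (j + 1)) (B ⟨j, hj⟩)) :
    IsHyperbolic (hermitian n) (partialWedge B j) (B ⟨j, hj⟩) ∧
      hyperbolicityCone (hermitian n) (partialWedge B (j + 1)) (B ⟨j, hj⟩) ⊆
        hyperbolicityCone (hermitian n) (partialWedge B j) (B ⟨j, hj⟩) :=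
  have hf := isRealForm_partialWedge hB (Nat.succ_le_of_lt hj)
  ⟨hf.isHyperbolic_derivative (hasDerivAt_partialWedge B hj) (partialWedge_succ_self B hj) h,
    hf.cone_subset_derivative (hasDerivAt_partialWedge B hj) h⟩

/-- Gårding's positivity of the polarized form on the hyperbolicity cone. -/
theorem partialWedge_zero_pos {B : Fin n → Matrix (Fin n) (Fin n) ℂ}
    (hB : ∀ i, (B i).IsHermitian) {j : ℕ} (hj : j ≤ n) {e : Matrix (Fin n) (Fin n) ℂ}
    (he : IsHyperbolic (hermitian n) (partialWedge B j) e)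
    (hcone : ∀ i : Fin n, (i : ℕ) < j →
      B i ∈ hyperbolicityCone (hermitian n) (partialWedge B j) e) :
    0 < (wedge B).re := by
  induction j generalizing e with
  | zero => simpa [partialWedge] using he.2.1
  | succ j ih =>
    have hf := isRealForm_partialWedge hB hj
    -- Change the direction from `e` to `B j` and differentiate along it: the other `B i` stay in
    -- the cone. At degree zero the form is the constant `wedge B`.
    have hm := hcone ⟨j, hj⟩ (Nat.lt_succ_self j)
    have h1 := hf.isHyperbolic_of_mem_cone he hm
    have h2 := isHyperbolic_partialWedge_pred hB hj h1
    exact ih (by omega) h2.1 fun i hi => h2.2 (hf.cone_subset he hm (hcone i (by omega)))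

/-- A kernel vector `v` would give `v* x v + t ‖v‖² = 0`, whose imaginary part is `t.im ‖v‖²`. -/
theorem det_add_smul_one_ne_zero {x : Matrix (Fin n) (Fin n) ℂ} (hx : x.IsHermitian) {t : ℂ}
    (ht : t.im ≠ 0) : (x + t • (1 : Matrix (Fin n) (Fin n) ℂ)).det ≠ 0 := by
  intro h0
  obtain ⟨v, hv, h⟩ := Matrix.exists_mulVec_eq_zero_iff.mpr h0
  have h1 := congrArg (fun w => star v ⬝ᵥ w) h
  simp only [Matrix.add_mulVec, Matrix.smul_mulVec, Matrix.one_mulVec, dotProduct_add,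
    dotProduct_smul, dotProduct_zero, smul_eq_mul] at h1
  obtain ⟨h2, h3⟩ := Complex.pos_iff.mp (Matrix.dotProduct_star_self_pos_iff.mpr hv)
  have h4 : (star v ⬝ᵥ x.mulVec v).im = 0 := hx.im_star_dotProduct_mulVec_self v
  have h5 := congrArg Complex.im h1
  simp only [Complex.add_im, Complex.mul_im, ← h3, mul_zero, zero_add, Complex.zero_im, h4] at h5
  exact (mul_ne_zero ht h2.ne') h5

theorem det_add_smul_one_ne_zero_of_posSemidef {x : Matrix (Fin n) (Fin n) ℂ}
    (hx : x.PosSemidef) {t : ℂ} (ht : 0 < t.re) :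
    (x + t • (1 : Matrix (Fin n) (Fin n) ℂ)).det ≠ 0 := by
  intro h0
  obtain ⟨v, hv, h⟩ := Matrix.exists_mulVec_eq_zero_iff.mpr h0
  have h1 := congrArg (fun w => star v ⬝ᵥ w) h
  simp only [Matrix.add_mulVec, Matrix.smul_mulVec, Matrix.one_mulVec, dotProduct_add,
    dotProduct_smul, dotProduct_zero, smul_eq_mul] at h1
  obtain ⟨h2, h3⟩ := Complex.pos_iff.mp (Matrix.dotProduct_star_self_pos_iff.mpr hv)
  obtain ⟨h4, -⟩ := Complex.nonneg_iff.mp (hx.dotProduct_mulVec_nonneg v)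
  have h5 := congrArg Complex.re h1
  simp only [Complex.add_re, Complex.mul_re, ← h3, mul_zero, sub_zero, Complex.zero_re] at h5
  nlinarith [mul_pos ht h2]

theorem partialWedge_top (B : Fin n → Matrix (Fin n) (Fin n) ℂ) (x : Matrix (Fin n) (Fin n) ℂ) :
    partialWedge B n x = (n.factorial : ℂ) * x.det := by
  rw [← wedge_const]
  simp [partialWedge]

/-- The forms `x^j ∧ β^(n-j) ∧ …` are hyperbolic in the direction `β`, and their hyperbolicity
cones decrease in `j`. -/
theorem isHyperbolic_partialWedge_one {B : Fin n → Matrix (Fin n) (Fin n) ℂ}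
    (hB : ∀ i, (B i).IsHermitian) {m : ℕ} (hone : ∀ i : Fin n, m ≤ (i : ℕ) → B i = 1) {j : ℕ}
    (hmj : m ≤ j) (hj : j ≤ n) :
    IsHyperbolic (hermitian n) (partialWedge B j) 1 ∧
      hyperbolicityCone (hermitian n) (partialWedge B n) 1 ⊆
        hyperbolicityCone (hermitian n) (partialWedge B j) 1 := by
  induction hj using Nat.decreasingInduction with
  | self =>
    refine ⟨⟨selfAdjoint.mem_iff.mpr (star_one _), ?_, fun x hx t ht => ?_⟩, subset_rfl⟩
    · rw [partialWedge_top]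
      simp [Nat.factorial_pos]
    · rw [partialWedge_top]
      exact mul_ne_zero (by exact_mod_cast n.factorial_ne_zero) (det_add_smul_one_ne_zero hx ht)
  | of_succ j hj ih =>
    obtain ⟨h1, h2⟩ := ih (by omega)
    have h3 := isHyperbolic_partialWedge_pred hB hj
    rw [hone ⟨j, hj⟩ hmj] at h3
    exact ⟨(h3 h1).1, h2.trans (h3 h1).2⟩

/-- Induction on `k`: the derivative in `s` is a positive multiple of the form of degree one lower,
so the form increases strictly from its value at `s = 0`, which `Gamma` makes nonnegative. -/
theorem partialWedge_one_pos_of_mem_Gamma {A : Matrix (Fin n) (Fin n) ℂ} {m : ℕ}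
    (hA : A ∈ Gamma n m) {k : ℕ} (hk : k ≤ m) (hkn : k ≤ n) {s : ℝ} (hs : 0 < s) :
    0 < (partialWedge (fun _ => 1) k (A + (s : ℂ) • 1)).re := by
  induction k generalizing s with
  | zero =>
    have := wedge_const (1 : Matrix (Fin n) (Fin n) ℂ)
    simp only [partialWedge, not_lt_zero, if_false, this]
    simp [Nat.factorial_pos]
  | succ k ih =>
    have hder : ∀ r : ℝ, HasDerivAt
        (fun r : ℝ => (partialWedge (fun _ => 1) (k + 1) (A + (r : ℂ) • 1)).re)
        (((k : ℂ) + 1) * partialWedge (fun _ => 1) k (A + (r : ℂ) • 1)).re r := fun r =>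
      (hasDerivAt_partialWedge (fun _ => 1) (show k < n by omega) A r).real_of_complex
    have hmono : StrictMonoOn
        (fun r : ℝ => (partialWedge (fun _ => 1) (k + 1) (A + (r : ℂ) • 1)).re)
        (Set.Ici 0) := by
      refine strictMonoOn_of_deriv_pos (convex_Ici 0)
        (fun r _ => (hder r).continuousAt.continuousWithinAt) fun r hr => ?_
      rw [interior_Ici] at hr
      rw [(hder r).deriv]
      have h1 := ih (by omega) (by omega) hr
      have h2 : (((k : ℂ) + 1) * partialWedge (fun _ => 1) k (A + (r : ℂ) • 1)).re
          = ((k : ℝ) + 1) * (partialWedge (fun _ => 1) k (A + (r : ℂ) • 1)).re := by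
        rw [← Complex.re_ofReal_mul]
        push_cast
        rfl
      rw [h2]
      positivity
    have h3 := hmono (Set.self_mem_Ici) (Set.mem_Ici.mpr hs.le) hs
    refine lt_of_le_of_lt ?_ h3
    have := hA.2 (k + 1) (by omega) hk
    simpa [partialWedge] using this

/-- Links `Gamma`, given by inequalities, to a hyperbolicity cone: real `t` is settled by the
previous positivity, nonreal `t` by hyperbolicity along `1`. -/
theorem add_smul_one_mem_cone {A : Matrix (Fin n) (Fin n) ℂ} {m : ℕ} (hmn : m ≤ n)
    (hA : A ∈ Gamma n m) {B : Fin n → Matrix (Fin n) (Fin n) ℂ}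
    (hB : ∀ i, (B i).IsHermitian) (hone : ∀ i : Fin n, m ≤ (i : ℕ) → B i = 1) {ε : ℝ}
    (hε : 0 < ε) :
    A + (ε : ℂ) • (1 : Matrix (Fin n) (Fin n) ℂ) ∈
      hyperbolicityCone (hermitian n) (partialWedge B m) 1 := by
  have hmem : A + (ε : ℂ) • (1 : Matrix (Fin n) (Fin n) ℂ) ∈ hermitian n :=
    (hermitian n).add_mem hA.1 ((isRealForm_partialWedge hB hmn).smul_mem ε 1
      (selfAdjoint.mem_iff.mpr (star_one _)))
  refine ⟨hmem, fun t ht => ?_⟩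
  by_cases him : t.im = 0
  · have htr : t = (t.re : ℂ) := Complex.ext rfl (by simpa using him)
    have h1 := partialWedge_one_pos_of_mem_Gamma hA le_rfl hmn (s := ε + t.re) (by linarith)
    have h2 : partialWedge (fun _ => 1) m = partialWedge B m := by
      funext x
      unfold partialWedge
      congr 1
      funext i
      split_ifs with hi
      · rfl
      · rw [hone i (not_lt.mp hi)]
    have h3 : A + ((ε + t.re : ℝ) : ℂ) • (1 : Matrix (Fin n) (Fin n) ℂ)
        = A + (ε : ℂ) • 1 + t • 1 := by
      rw [Complex.ofReal_add, add_smul, add_assoc, ← htr]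
    rw [h2, h3] at h1
    intro h0
    rw [h0] at h1
    exact lt_irrefl _ h1
  · exact (isHyperbolic_partialWedge_one hB hone le_rfl hmn).1.2.2 _ hmem t him

/-- Gårding's inequality: `P ∧ α_1 ∧ ⋯ ∧ α_{m-1} ∧ β^(n-m) ≥ 0` for `P ≥ 0` and `α_i ∈ Γ_m`. -/
theorem mWedge_nonneg {m : ℕ} (hm : 1 ≤ m) (hmn : m ≤ n) {P : Matrix (Fin n) (Fin n) ℂ}
    (hP : P.PosSemidef) {A : ℕ → Matrix (Fin n) (Fin n) ℂ} (hA : ∀ i, A i ∈ Gamma n m) :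
    0 ≤ mWedge m P A := by
  -- `P` and the `A i` may lie on the boundary of the cone; the shift by `ε` brings them inside,
  -- where strict positivity holds, and then `ε → 0`.
  set B : ℝ → Fin n → Matrix (Fin n) (Fin n) ℂ := fun ε i =>
    if (i : ℕ) < m then (if (i : ℕ) = 0 then P else A i) + (ε : ℂ) • 1 else 1 with hB
  have hpos : ∀ ε : ℝ, 0 < ε → 0 < (wedge (B ε)).re := by
    intro ε hε
    have hone1 : (1 : Matrix (Fin n) (Fin n) ℂ).IsHermitian := Matrix.isHermitian_one
    have hεone : ((ε : ℂ) • (1 : Matrix (Fin n) (Fin n) ℂ)).IsHermitian := by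
      unfold Matrix.IsHermitian
      simp [Matrix.conjTranspose_smul]
    have hBh : ∀ i, (B ε i).IsHermitian := by
      intro i
      simp only [hB]
      split_ifs
      · exact hP.1.add hεone
      · exact (hA i).1.add hεone
      · exact hone1
    have hone : ∀ i : Fin n, m ≤ (i : ℕ) → B ε i = 1 := by
      intro i hi
      simp [hB, hi.not_gt]
    have h1 := isHyperbolic_partialWedge_one hBh hone le_rfl hmn
    refine partialWedge_zero_pos hBh hmn h1.1 fun i hi => ?_
    by_cases hi0 : (i : ℕ) = 0
    -- The shifted `P` lies in the cone of the determinant, the smallest in the chain.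
    · refine h1.2 ⟨hBh i, fun t ht => ?_⟩
      have h2 : B ε i + t • (1 : Matrix (Fin n) (Fin n) ℂ) = P + ((ε : ℂ) + t) • 1 := by
        simp only [hB, if_pos hi, if_pos hi0, add_smul, add_assoc]
      rw [partialWedge_top, h2]
      refine mul_ne_zero (by exact_mod_cast n.factorial_ne_zero)
        (det_add_smul_one_ne_zero_of_posSemidef hP ?_)
      simp only [Complex.add_re, Complex.ofReal_re]
      linarith
    · have h2 : B ε i = A i + (ε : ℂ) • 1 := by simp [hB, hi, hi0]
      rw [h2]
      exact add_smul_one_mem_cone hmn (hA i) hBh hone hε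
  have hcont : Continuous fun ε => (wedge (B ε)).re := by
    refine Complex.continuous_re.comp (continuous_wedge.comp (continuous_pi fun i => ?_))
    simp only [hB]
    split_ifs <;> fun_prop
  have h0 : (wedge (B 0)).re = mWedge m P A := by
    unfold mWedge
    congr 2
    funext i
    by_cases hi0 : (i : ℕ) = 0
    · simp [hB, hi0, show 0 < m by omega]
    · simp [hB, hi0]
  rw [← h0]
  refine ge_of_tendsto (x := 𝓝[>] (0 : ℝ)) ((hcont.tendsto 0).mono_left nhdsWithin_le_nhds) ?_
  filter_upwards [self_mem_nhdsWithin] with ε hε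
  exact (hpos ε hε).le

end Wedge

/-! ### The operators as sums of squares of directional derivatives -/

section Representation

open scoped ComplexOrder MatrixOrder

variable {n : ℕ}

theorem prod_update_apply (M : Fin n → Matrix (Fin n) (Fin n) ℂ) (i : Fin n)
    (L : Matrix (Fin n) (Fin n) ℂ) (σ τ : Equiv.Perm (Fin n)) :
    ∏ j, Function.update M i L j (σ j) (τ j)
      = L (σ i) (τ i) * ∏ j ∈ Finset.univ.erase i, M j (σ j) (τ j) := by
  rw [← Finset.mul_prod_erase _ _ (Finset.mem_univ i), Function.update_self]
  congr 1
  exact Finset.prod_congr rfl fun j hj => by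
    rw [Function.update_of_ne (Finset.ne_of_mem_erase hj)]

/-- `wedge` as a linear function of its factor with index `i`. -/
def wedgeLinear (M : Fin n → Matrix (Fin n) (Fin n) ℂ) (i : Fin n) :
    Matrix (Fin n) (Fin n) ℂ →ₗ[ℂ] ℂ where
  toFun H := wedge (Function.update M i H)
  map_add' H K := by
    unfold wedge
    simp only [← Finset.sum_add_distrib, ← mul_add]
    refine Finset.sum_congr rfl fun σ _ => Finset.sum_congr rfl fun τ _ => ?_
    congr 1
    rw [prod_update_apply, prod_update_apply, prod_update_apply, Matrix.add_apply, add_mul]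
  map_smul' c H := by
    unfold wedge
    simp only [RingHom.id_apply, smul_eq_mul, Finset.mul_sum]
    refine Finset.sum_congr rfl fun σ _ => Finset.sum_congr rfl fun τ _ => ?_
    rw [mul_left_comm]
    congr 1
    rw [prod_update_apply, prod_update_apply, Matrix.smul_apply, smul_eq_mul, mul_assoc]

theorem linearMap_eq_sum_single (ℓ : Matrix (Fin n) (Fin n) ℂ →ₗ[ℂ] ℂ)
    (H : Matrix (Fin n) (Fin n) ℂ) : ℓ H = ∑ j, ∑ k, H j k * ℓ (Matrix.single j k 1) := by
  conv_lhs => rw [Matrix.matrix_eq_sum_single H]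
  simp only [map_sum]
  refine Finset.sum_congr rfl fun j _ => Finset.sum_congr rfl fun k _ => ?_
  rw [← smul_eq_mul, ← map_smul, Matrix.smul_single, smul_eq_mul, mul_one]

/-- `mWedge` as a positive Hermitian pairing with `H`. -/
theorem exists_mWedge_eq_sum {m : ℕ} (hm : 1 ≤ m) (hmn : m ≤ n)
    {A : ℕ → Matrix (Fin n) (Fin n) ℂ} (hA : ∀ i, A i ∈ Gamma n m) :
    ∃ w : Fin n → Fin n → ℂ, ∀ H : Matrix (Fin n) (Fin n) ℂ,
      mWedge m H A = (∑ l, ∑ j, ∑ k, H j k * (w l j * (starRingEnd ℂ) (w l k))).re := by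
  set i0 : Fin n := ⟨0, by omega⟩ with hi0
  set M : Fin n → Matrix (Fin n) (Fin n) ℂ := fun i => if (i : ℕ) < m then A i else 1 with hM
  have hMh : ∀ i, (M i).conjTranspose = M i := by
    intro i
    simp only [hM]
    split_ifs
    · exact (hA i).1
    · exact Matrix.conjTranspose_one
  have hmw : ∀ H, mWedge m H A = (wedgeLinear M i0 H).re := by
    intro H
    unfold mWedge wedgeLinear
    simp only [LinearMap.coe_mk, AddHom.coe_mk]
    congr 2
    funext i
    by_cases h : (i : ℕ) = 0
    · have : i = i0 := Fin.ext h
      rw [this, Function.update_self, if_pos rfl]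
    · rw [Function.update_of_ne fun h' => h (by rw [h']), if_neg h]
  have hconj : ∀ H, wedgeLinear M i0 H.conjTranspose = (starRingEnd ℂ) (wedgeLinear M i0 H) := by
    intro H
    unfold wedgeLinear
    simp only [LinearMap.coe_mk, AddHom.coe_mk]
    rw [← wedge_conjTranspose]
    congr 1
    funext i
    by_cases h : i = i0
    · rw [h, Function.update_self, Function.update_self]
    · rw [Function.update_of_ne h, Function.update_of_ne h, hMh]
  set b : Matrix (Fin n) (Fin n) ℂ := fun j k => wedgeLinear M i0 (Matrix.single j k 1) with hb
  have hbh : b.IsHermitian := by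
    ext j k
    rw [Matrix.conjTranspose_apply]
    simp only [hb]
    rw [← starRingEnd_apply, ← hconj, Matrix.conjTranspose_single, star_one]
  -- The quadratic form of `b` at `x` is the pairing with a rank-one positive matrix, so this is
  -- Gårding's inequality.
  have hpsd : b.PosSemidef := by
    refine Matrix.PosSemidef.of_dotProduct_mulVec_nonneg hbh fun x => ?_
    have h1 : star x ⬝ᵥ b.mulVec x = wedgeLinear M i0 (Matrix.vecMulVec (star x) x) := by
      rw [linearMap_eq_sum_single]
      simp only [dotProduct, Matrix.mulVec, Finset.mul_sum, Matrix.vecMulVec_apply, hb]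
      refine Finset.sum_congr rfl fun j _ => Finset.sum_congr rfl fun k _ => ?_
      ring
    rw [Complex.nonneg_iff]
    refine ⟨?_, ?_⟩
    · rw [h1, ← hmw]
      exact mWedge_nonneg hm hmn (Matrix.posSemidef_vecMulVec_star_self x) hA
    · exact (hbh.im_star_dotProduct_mulVec_self x).symm
  -- Writing `b = C* C` turns the pairing into a sum of Levi forms, one for each row of `C`.
  obtain ⟨C, hC⟩ := CStarAlgebra.nonneg_iff_eq_star_mul_self.mp hpsd.nonneg
  refine ⟨fun l j => (starRingEnd ℂ) (C l j), fun H => ?_⟩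
  rw [hmw, linearMap_eq_sum_single, Finset.sum_comm]
  congr 1
  have h2 : ∀ j k, wedgeLinear M i0 (Matrix.single j k 1)
      = ∑ l, (starRingEnd ℂ) (C l j) * C l k := by
    intro j k
    have := congrFun (congrFun hC j) k
    simpa [hb, Matrix.mul_apply, Matrix.star_apply] using this
  simp only [h2, Finset.mul_sum, Complex.conj_conj]
  rw [Finset.sum_comm]
  refine (Finset.sum_congr rfl fun j _ => Finset.sum_comm).trans ?_
  exact Finset.sum_comm

/-- The Levi form in the direction `w` is a sum of two real second derivatives. -/
theorem re_sum_complexHessian (φ : Cn n → ℝ) (z : Cn n) (w : Fin n → ℂ) :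
    (∑ j, ∑ k, complexHessian φ z j k * (w j * (starRingEnd ℂ) (w k))).re
      = (1 / 4) * (secondDeriv φ z (∑ j, dir j (w j)) (∑ j, dir j (w j))
        + secondDeriv φ z (∑ j, dir j (Complex.I * w j)) (∑ j, dir j (Complex.I * w j))) := by
  set D := fderiv ℝ (fderiv ℝ φ) z with hD
  have hdir : ∀ (j : Fin n) (c : ℂ), dir j c = c.re • dir j 1 + c.im • dir j Complex.I := by
    intro j c
    ext k
    by_cases h : k = j
    · subst h
      apply Complex.ext <;> simp [dir]
    · simp [dir, h]
  simp only [Complex.re_sum, secondDeriv, ← hD, map_sum, sum_apply,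
    ← Finset.sum_add_distrib, Finset.mul_sum]
  rw [Finset.sum_comm]
  refine Finset.sum_congr rfl fun k _ => Finset.sum_congr rfl fun j _ => ?_
  rw [hdir k (w k), hdir j (w j), hdir k (Complex.I * w k), hdir j (Complex.I * w j)]
  simp only [complexHessian, secondDeriv, ← hD, map_add, map_smul, add_apply,
    smul_apply, smul_eq_mul]
  simp
  ring

/-- For `α_i ∈ Γ_m` the operator `φ ↦ dd^c φ ∧ α_1 ∧ ⋯ ∧ α_{m-1} ∧ β^(n-m)` is a sum of pure second
derivatives. -/
theorem exists_directions {m : ℕ} (hm : 1 ≤ m) (hmn : m ≤ n)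
    {A : ℕ → Matrix (Fin n) (Fin n) ℂ} (hA : ∀ i, A i ∈ Gamma n m) :
    ∃ ξ : Fin n ⊕ Fin n → Cn n, ∀ (φ : Cn n → ℝ) (z : Cn n),
      mWedge m (complexHessian φ z) A = ∑ l, fderiv ℝ (fderiv ℝ φ) z (ξ l) (ξ l) := by
  obtain ⟨w, hw⟩ := exists_mWedge_eq_sum hm hmn hA
  -- The scaling by `1 / 2`, squared, absorbs the factor `1 / 4` of the complex Hessian.
  refine ⟨Sum.elim (fun l => (1 / 2 : ℝ) • ∑ j, dir j (w l j))
    (fun l => (1 / 2 : ℝ) • ∑ j, dir j (Complex.I * w l j)), fun φ z => ?_⟩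
  rw [hw, Fintype.sum_sum_type, ← Finset.sum_add_distrib, Complex.re_sum]
  refine Finset.sum_congr rfl fun l _ => ?_
  rw [re_sum_complexHessian]
  simp only [Sum.elim_inl, Sum.elim_inr, map_smul, smul_apply, smul_eq_mul,
    secondDeriv]
  ring

end Representation

/-! ### Weak and smooth subsolutions of constant-coefficient operators -/

section Subsolutions

set_option linter.unusedSectionVars false

variable {E : Type*} [NormedAddCommGroup E] [NormedSpace ℝ E]

/-- The derivative of `f` in the direction `a`. -/
def dirDeriv (a : E) (f : E → ℝ) : E → ℝ := fun x => fderiv ℝ f x a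

/-- The operator `φ ↦ ∑ ∂²φ/∂ξ_l²`. -/
def diffOp {ι : Type*} [Fintype ι] (ξ : ι → E) (φ : E → ℝ) (x : E) : ℝ :=
  ∑ l, fderiv ℝ (fderiv ℝ φ) x (ξ l) (ξ l)

theorem contDiff_dirDeriv {f : E → ℝ} (hf : ContDiff ℝ (⊤ : ℕ∞) f) (a : E) :
    ContDiff ℝ (⊤ : ℕ∞) (dirDeriv a f) :=
  (hf.fderiv_right (m := (⊤ : ℕ∞)) (by simp)).clm_apply contDiff_const

theorem smooth_differentiable {f : E → ℝ} (hf : ContDiff ℝ (⊤ : ℕ∞) f) : Differentiable ℝ f :=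
  hf.differentiable (by simp)

theorem dirDeriv_dirDeriv {f : E → ℝ} (hf : ContDiff ℝ (⊤ : ℕ∞) f) (a : E) (x : E) :
    fderiv ℝ (fderiv ℝ f) x a a = dirDeriv a (dirDeriv a f) x := by
  have h : HasFDerivAt (fderiv ℝ f) (fderiv ℝ (fderiv ℝ f) x) x :=
    ((hf.fderiv_right (m := (⊤ : ℕ∞)) (by simp)).differentiable (by simp) x).hasFDerivAt
  have h2 := (h.clm_apply (hasFDerivAt_const a x)).fderiv
  unfold dirDeriv
  rw [h2]
  simp

variable {ι : Type*} [Fintype ι] {ξ : ι → E}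

theorem diffOp_eq {f : E → ℝ} (hf : ContDiff ℝ (⊤ : ℕ∞) f) (x : E) :
    diffOp ξ f x = ∑ l, dirDeriv (ξ l) (dirDeriv (ξ l) f) x :=
  Finset.sum_congr rfl fun l _ => dirDeriv_dirDeriv hf (ξ l) x

theorem continuous_diffOp {f : E → ℝ} (hf : ContDiff ℝ (⊤ : ℕ∞) f) :
    Continuous (diffOp ξ f) := by
  rw [show diffOp ξ f = _ from funext fun x => diffOp_eq hf x]
  exact continuous_finsetSum _ fun l _ =>
    (contDiff_dirDeriv (contDiff_dirDeriv hf _) _).continuous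

theorem dirDeriv_add {f g : E → ℝ} (hf : ContDiff ℝ (⊤ : ℕ∞) f) (hg : ContDiff ℝ (⊤ : ℕ∞) g)
    (a : E) : dirDeriv a (fun x => f x + g x) = fun x => dirDeriv a f x + dirDeriv a g x := by
  funext x
  unfold dirDeriv
  rw [fderiv_fun_add (smooth_differentiable hf x) (smooth_differentiable hg x)]
  rfl

theorem dirDeriv_const_mul {f : E → ℝ} (hf : ContDiff ℝ (⊤ : ℕ∞) f) (c : ℝ) (a : E) :
    dirDeriv a (fun x => c * f x) = fun x => c * dirDeriv a f x := by
  funext x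
  unfold dirDeriv
  rw [fderiv_const_mul (smooth_differentiable hf x)]
  rfl

theorem dirDeriv_mul {f g : E → ℝ} (hf : ContDiff ℝ (⊤ : ℕ∞) f) (hg : ContDiff ℝ (⊤ : ℕ∞) g)
    (a : E) :
    dirDeriv a (fun x => f x * g x) = fun x => f x * dirDeriv a g x + g x * dirDeriv a f x := by
  funext x
  unfold dirDeriv
  rw [fderiv_fun_mul (smooth_differentiable hf x) (smooth_differentiable hg x)]
  rfl

theorem diffOp_add {f g : E → ℝ} (hf : ContDiff ℝ (⊤ : ℕ∞) f) (hg : ContDiff ℝ (⊤ : ℕ∞) g)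
    (x : E) : diffOp ξ (fun x => f x + g x) x = diffOp ξ f x + diffOp ξ g x := by
  rw [diffOp_eq (hf.add hg), diffOp_eq hf, diffOp_eq hg, ← Finset.sum_add_distrib]
  refine Finset.sum_congr rfl fun l _ => ?_
  rw [dirDeriv_add hf hg, dirDeriv_add (contDiff_dirDeriv hf _) (contDiff_dirDeriv hg _)]

theorem diffOp_const_mul {f : E → ℝ} (hf : ContDiff ℝ (⊤ : ℕ∞) f) (c : ℝ) (x : E) :
    diffOp ξ (fun x => c * f x) x = c * diffOp ξ f x := by
  rw [diffOp_eq (contDiff_const.mul hf), diffOp_eq hf, Finset.mul_sum]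
  refine Finset.sum_congr rfl fun l _ => ?_
  rw [dirDeriv_const_mul hf, dirDeriv_const_mul (contDiff_dirDeriv hf _)]

theorem dirDeriv_comp_const_sub {f : E → ℝ} (hf : ContDiff ℝ (⊤ : ℕ∞) f) (x a : E) :
    dirDeriv a (fun t => f (x - t)) = fun t => (-1) * dirDeriv a f (x - t) := by
  funext t
  unfold dirDeriv
  have h1 : HasFDerivAt (fun t : E => x - t) (-ContinuousLinearMap.id ℝ E) t :=
    (hasFDerivAt_id t).const_sub x
  have h2 := ((smooth_differentiable hf (x - t)).hasFDerivAt.comp t h1).fderiv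
  rw [show (fun t => f (x - t)) = f ∘ fun t => x - t from rfl, h2]
  simp

theorem contDiff_comp_const_sub {f : E → ℝ} (hf : ContDiff ℝ (⊤ : ℕ∞) f) (x : E) :
    ContDiff ℝ (⊤ : ℕ∞) fun t => f (x - t) :=
  hf.comp (contDiff_const.sub contDiff_id)

theorem diffOp_comp_const_sub {f : E → ℝ} (hf : ContDiff ℝ (⊤ : ℕ∞) f) (x t : E) :
    diffOp ξ (fun t => f (x - t)) t = diffOp ξ f (x - t) := by
  rw [diffOp_eq (contDiff_comp_const_sub hf x), diffOp_eq hf]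
  refine Finset.sum_congr rfl fun l _ => ?_
  rw [dirDeriv_comp_const_sub hf,
    dirDeriv_const_mul (contDiff_comp_const_sub (contDiff_dirDeriv hf _) x),
    dirDeriv_comp_const_sub (contDiff_dirDeriv hf _)]
  ring

theorem support_diffOp_subset (f : E → ℝ) : Function.support (diffOp ξ f) ⊆ tsupport f := by
  intro x hx
  by_contra hn
  apply hx
  have h : x ∉ tsupport (fderiv ℝ (fderiv ℝ f)) := fun h =>
    hn (tsupport_fderiv_subset ℝ (tsupport_fderiv_subset ℝ h))
  simp [diffOp, image_eq_zero_of_notMem_tsupport h]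

theorem tsupport_diffOp_subset (f : E → ℝ) : tsupport (diffOp ξ f) ⊆ tsupport f :=
  closure_minimal (support_diffOp_subset f) (isClosed_tsupport f)

theorem hasCompactSupport_diffOp {f : E → ℝ} (hf : HasCompactSupport f) :
    HasCompactSupport (diffOp ξ f) :=
  hf.mono' (support_diffOp_subset f)

/-- The regularized maximum of two subsolutions is a subsolution. -/
theorem diffOp_smoothMax_nonneg {f g : E → ℝ} (hf : ContDiff ℝ (⊤ : ℕ∞) f)
    (hg : ContDiff ℝ (⊤ : ℕ∞) g) {δ : ℝ} (hδ : 0 < δ) {x : E} (hfx : 0 ≤ diffOp ξ f x)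
    (hgx : 0 ≤ diffOp ξ g x) :
    ContDiff ℝ (⊤ : ℕ∞) (fun y => (1 / 2) * ((f y + g y) + √((f y + -1 * g y) ^ 2 + δ ^ 2))) ∧
      0 ≤ diffOp ξ (fun y => (1 / 2) * ((f y + g y) + √((f y + -1 * g y) ^ 2 + δ ^ 2))) x := by
  set h : E → ℝ := fun y => f y + -1 * g y with hh
  have hhs : ContDiff ℝ (⊤ : ℕ∞) h := hf.add (contDiff_const.mul hg)
  set N : E → ℝ := fun y => √(h y ^ 2 + δ ^ 2) with hN
  have hpos : ∀ y, 0 < h y ^ 2 + δ ^ 2 := fun y => by positivity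
  have hNs : ContDiff ℝ (⊤ : ℕ∞) N :=
    ((hhs.pow 2).add contDiff_const).sqrt fun y => (hpos y).ne'
  have hNpos : ∀ y, 0 < N y := fun y => Real.sqrt_pos.mpr (hpos y)
  have hsq : ∀ y, N y * N y = h y * h y + δ ^ 2 := fun y => by
    rw [hN]
    simp only [Real.mul_self_sqrt (hpos y).le]
    ring
  have h1 : ∀ (a y : E), N y * dirDeriv a N y = h y * dirDeriv a h y := by
    intro a y
    have e1 := congrFun (dirDeriv_mul hNs hNs a) y
    have e2 := congrFun (dirDeriv_mul hhs hhs a) y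
    have e3 : dirDeriv a (fun y => N y * N y) y = dirDeriv a (fun y => h y * h y) y := by
      rw [show (fun y => N y * N y) = fun y => h y * h y + δ ^ 2 from funext hsq,
        dirDeriv_add (hhs.mul hhs) contDiff_const]
      simp [dirDeriv]
    rw [e1, e2] at e3
    linarith
  -- Differentiate `N N' = h h'` once more; the first-order terms satisfy `N'² ≤ h'²`, because `N²
  -- N'² = h² h'²` and `h² ≤ N²`.
  have h2 : ∀ a : E, h x * dirDeriv a (dirDeriv a h) x ≤ N x * dirDeriv a (dirDeriv a N) x := by
    intro a
    have e1 := congrFun (dirDeriv_mul hNs (contDiff_dirDeriv hNs a) a) x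
    have e2 := congrFun (dirDeriv_mul hhs (contDiff_dirDeriv hhs a) a) x
    rw [show (fun y => N y * dirDeriv a N y) = fun y => h y * dirDeriv a h y from
      funext fun y => h1 a y, e2] at e1
    have e3 : dirDeriv a N x * dirDeriv a N x ≤ dirDeriv a h x * dirDeriv a h x := by
      have e4 : (N x * N x) * (dirDeriv a N x * dirDeriv a N x)
          = (h x * h x) * (dirDeriv a h x * dirDeriv a h x) := by
        linear_combination (N x * dirDeriv a N x + h x * dirDeriv a h x) * h1 a x
      have e5 : h x * h x ≤ N x * N x := by rw [hsq]; nlinarith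
      have e6 : (N x * N x) * (dirDeriv a N x * dirDeriv a N x)
          ≤ (N x * N x) * (dirDeriv a h x * dirDeriv a h x) := by
        rw [e4]
        exact mul_le_mul_of_nonneg_right e5 (mul_self_nonneg _)
      exact le_of_mul_le_mul_left e6 (mul_pos (hNpos x) (hNpos x))
    linarith
  have h3 : h x * diffOp ξ h x ≤ N x * diffOp ξ N x := by
    rw [diffOp_eq hhs, diffOp_eq hNs, Finset.mul_sum, Finset.mul_sum]
    exact Finset.sum_le_sum fun l _ => h2 (ξ l)
  have h4 : diffOp ξ h x = diffOp ξ f x - diffOp ξ g x := by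
    rw [hh, diffOp_add hf (contDiff_const.mul hg), diffOp_const_mul hg]
    ring
  have hfg : ContDiff ℝ (⊤ : ℕ∞) fun y => f y + g y := hf.add hg
  have hsum : ContDiff ℝ (⊤ : ℕ∞) fun y => (f y + g y) + N y := hfg.add hNs
  refine ⟨contDiff_const.mul hsum, ?_⟩
  rw [diffOp_const_mul hsum, diffOp_add hfg hNs, diffOp_add hf hg]
  have habs : |h x| ≤ N x := Real.abs_le_sqrt (by nlinarith)
  obtain ⟨h5, h6⟩ := abs_le.mp habs
  -- With `L = diffOp ξ`, this is at least `(N + h) L f + (N - h) L g`, and `|h| ≤ N`.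
  have h7 : 0 ≤ N x * (diffOp ξ f x + diffOp ξ g x + diffOp ξ N x) := by
    rw [h4] at h3
    nlinarith
  have := nonneg_of_mul_nonneg_right h7 (hNpos x)
  linarith

theorem abs_smoothMax_sub_max_le (a b : ℝ) {δ : ℝ} (hδ : 0 < δ) :
    |(1 / 2) * ((a + b) + √((a + -1 * b) ^ 2 + δ ^ 2)) - max a b| ≤ δ := by
  have h1 : |a + -1 * b| ≤ √((a + -1 * b) ^ 2 + δ ^ 2) := Real.abs_le_sqrt (by nlinarith)
  have h2 : √((a + -1 * b) ^ 2 + δ ^ 2) ≤ |a + -1 * b| + δ := by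
    refine Real.sqrt_le_iff.mpr ⟨by positivity, ?_⟩
    nlinarith [sq_abs (a + -1 * b), mul_nonneg (abs_nonneg (a + -1 * b)) hδ.le]
  have h3 : max a b = (1 / 2) * ((a + b) + |a + -1 * b|) := by
    rcases le_total a b with h | h
    · rw [max_eq_right h, abs_of_nonpos (by linarith)]; ring
    · rw [max_eq_left h, abs_of_nonneg (by linarith)]; ring
  rw [h3, abs_le]
  constructor <;> linarith

variable [MeasurableSpace E] [BorelSpace E]

/-- `u` satisfies `∑ ∂²u/∂ξ_l² ≥ 0` on `Ω` in the sense of distributions. -/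
def IsWeakSubsolution (μ : Measure E) (ξ : ι → E) (Ω : Set E) (u : E → ℝ) : Prop :=
  ∀ φ : E → ℝ, ContDiff ℝ (⊤ : ℕ∞) φ → HasCompactSupport φ → tsupport φ ⊆ Ω →
    (∀ x, 0 ≤ φ x) → 0 ≤ ∫ x, u x * diffOp ξ φ x ∂μ

/-- `u` is a locally uniform limit on `Ω` of smooth functions which are subsolutions on compact
subsets. -/
def IsApproxSubsolution (ξ : ι → E) (Ω : Set E) (u : E → ℝ) : Prop :=
  ∀ K ⊆ Ω, IsCompact K → ∀ η : ℝ, 0 < η → ∃ g : E → ℝ, ContDiff ℝ (⊤ : ℕ∞) g ∧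
    ∀ x ∈ K, |g x - u x| ≤ η ∧ 0 ≤ diffOp ξ g x

theorem IsApproxSubsolution.sup {Ω : Set E} {u v : E → ℝ} (hu : IsApproxSubsolution ξ Ω u)
    (hv : IsApproxSubsolution ξ Ω v) : IsApproxSubsolution ξ Ω (fun x => max (u x) (v x)) := by
  intro K hK hKc η hη
  obtain ⟨f, hf, hfK⟩ := hu K hK hKc (η / 2) (by positivity)
  obtain ⟨g, hg, hgK⟩ := hv K hK hKc (η / 2) (by positivity)
  have hη2 : 0 < η / 2 := by positivity
  refine ⟨fun y => (1 / 2) * ((f y + g y) + √((f y + -1 * g y) ^ 2 + (η / 2) ^ 2)), ?_,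
    fun x hx => ⟨?_, ?_⟩⟩
  · have hh : ContDiff ℝ (⊤ : ℕ∞) fun y => (f y + -1 * g y) ^ 2 + (η / 2) ^ 2 :=
      ((hf.add (contDiff_const.mul hg)).pow 2).add contDiff_const
    exact contDiff_const.mul ((hf.add hg).add (hh.sqrt fun y => by positivity))
  · have h1 := abs_smoothMax_sub_max_le (f x) (g x) hη2
    have h2 : |max (f x) (g x) - max (u x) (v x)| ≤ η / 2 :=
      (abs_max_sub_max_le_max _ _ _ _).trans (max_le (hfK x hx).1 (hgK x hx).1)
    have := abs_sub_le ((1 / 2) * ((f x + g x) + √((f x + -1 * g x) ^ 2 + (η / 2) ^ 2)))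
      (max (f x) (g x)) (max (u x) (v x))
    linarith
  · exact (diffOp_smoothMax_nonneg hf hg hη2 (hfK x hx).2 (hgK x hx).2).2

theorem IsApproxSubsolution.add {Ω : Set E} {u v : E → ℝ} (hu : IsApproxSubsolution ξ Ω u)
    (hv : IsApproxSubsolution ξ Ω v) : IsApproxSubsolution ξ Ω (fun x => u x + v x) := by
  intro K hK hKc η hη
  obtain ⟨f, hf, hfK⟩ := hu K hK hKc (η / 2) (by positivity)
  obtain ⟨g, hg, hgK⟩ := hv K hK hKc (η / 2) (by positivity)
  refine ⟨fun y => f y + g y, hf.add hg, fun x hx => ⟨?_, ?_⟩⟩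
  · have := abs_add_le (f x - u x) (g x - v x)
    rw [show f x + g x - (u x + v x) = (f x - u x) + (g x - v x) by ring]
    linarith [(hfK x hx).1, (hgK x hx).1]
  · rw [diffOp_add hf hg]
    exact add_nonneg (hfK x hx).2 (hgK x hx).2

theorem IsApproxSubsolution.const_mul {Ω : Set E} {u : E → ℝ} (hu : IsApproxSubsolution ξ Ω u)
    {c : ℝ} (hc : 0 ≤ c) : IsApproxSubsolution ξ Ω (fun x => c * u x) := by
  intro K hK hKc η hη
  -- Dividing by `c + 1` rather than `c` also covers `c = 0`.
  obtain ⟨f, hf, hfK⟩ := hu K hK hKc (η / (c + 1)) (by positivity)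
  refine ⟨fun y => c * f y, contDiff_const.mul hf, fun x hx => ⟨?_, ?_⟩⟩
  · rw [← mul_sub, abs_mul, abs_of_nonneg hc]
    calc c * |f x - u x| ≤ (c + 1) * (η / (c + 1)) :=
          mul_le_mul (by linarith) (hfK x hx).1 (abs_nonneg _) (by linarith)
      _ = η := by field_simp
  · rw [diffOp_const_mul hf]
    exact mul_nonneg hc (hfK x hx).2

theorem isApproxSubsolution_of_contDiff {Ω : Set E} {u : E → ℝ} (hu : ContDiff ℝ (⊤ : ℕ∞) u)
    (h : ∀ x, 0 ≤ diffOp ξ u x) : IsApproxSubsolution ξ Ω u :=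
  fun _ _ _ η hη => ⟨u, hu, fun x _ => ⟨by simpa using hη.le, h x⟩⟩

variable [FiniteDimensional ℝ E] {μ : Measure E} [μ.IsAddHaarMeasure]

theorem integrable_mul_of_tsupport_subset {Ω : Set E} (hΩ : IsOpen Ω) {u ψ : E → ℝ}
    (hu : ContinuousOn u Ω) (hψ : Continuous ψ) (hc : HasCompactSupport ψ)
    (hs : tsupport ψ ⊆ Ω) : Integrable (fun x => u x * ψ x) μ := by
  have hcs : HasCompactSupport fun x => u x * ψ x := hc.mul_left
  refine Continuous.integrable_of_hasCompactSupport ?_ hcs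
  refine continuous_of_tsupport fun x hx => ?_
  have hx' : x ∈ Ω := hs (closure_mono (Function.support_mul_subset_right u ψ) hx)
  exact (hu.continuousAt (hΩ.mem_nhds hx')).mul hψ.continuousAt

theorem integral_mul_dirDeriv {f g : E → ℝ} (hf : ContDiff ℝ (⊤ : ℕ∞) f)
    (hg : ContDiff ℝ (⊤ : ℕ∞) g) (hgc : HasCompactSupport g) (a : E) :
    ∫ x, f x * dirDeriv a g x ∂μ = -∫ x, dirDeriv a f x * g x ∂μ := by
  have hda : HasCompactSupport (dirDeriv a g) := hgc.fderiv_apply ℝ a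
  refine integral_mul_fderiv_eq_neg_fderiv_mul_of_integrable ?_ ?_ ?_
    (fun x _ => smooth_differentiable hf x) (fun x _ => smooth_differentiable hg x)
  · exact ((contDiff_dirDeriv hf a).continuous.mul hg.continuous).integrable_of_hasCompactSupport
      hgc.mul_left
  · exact (hf.continuous.mul (contDiff_dirDeriv hg a).continuous).integrable_of_hasCompactSupport
      hda.mul_left
  · exact (hf.continuous.mul hg.continuous).integrable_of_hasCompactSupport hgc.mul_left

/-- Green's formula. -/
theorem integral_mul_diffOp {f g : E → ℝ} (hf : ContDiff ℝ (⊤ : ℕ∞) f)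
    (hg : ContDiff ℝ (⊤ : ℕ∞) g) (hgc : HasCompactSupport g) :
    ∫ x, f x * diffOp ξ g x ∂μ = ∫ x, diffOp ξ f x * g x ∂μ := by
  simp only [diffOp_eq hf, diffOp_eq hg, Finset.mul_sum, Finset.sum_mul]
  have hc1 : ∀ a, HasCompactSupport (dirDeriv a g) := fun a => hgc.fderiv_apply ℝ a
  have hc2 : ∀ a, HasCompactSupport (dirDeriv a (dirDeriv a g)) := fun a =>
    (hc1 a).fderiv_apply ℝ a
  rw [integral_finsetSum, integral_finsetSum]
  · refine Finset.sum_congr rfl fun l _ => ?_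
    rw [integral_mul_dirDeriv hf (contDiff_dirDeriv hg _) (hc1 _),
      integral_mul_dirDeriv (contDiff_dirDeriv hf _) hg hgc, neg_neg]
  · exact fun l _ => ((contDiff_dirDeriv (contDiff_dirDeriv hf _) _).continuous.mul
      hg.continuous).integrable_of_hasCompactSupport hgc.mul_left
  · exact fun l _ => (hf.continuous.mul (contDiff_dirDeriv (contDiff_dirDeriv hg _)
      _).continuous).integrable_of_hasCompactSupport (hc2 _).mul_left

/-- For a smooth approximant, Green's formula moves the operator off `φ`; replacing it by `u` costs
at most `η ∫ |diffOp ξ φ|`. -/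
theorem IsApproxSubsolution.isWeakSubsolution {Ω : Set E} (hΩ : IsOpen Ω) {u : E → ℝ}
    (hu : ContinuousOn u Ω) (h : IsApproxSubsolution ξ Ω u) : IsWeakSubsolution μ ξ Ω u := by
  intro φ hφ hφc hφΩ hφ0
  have hLc : HasCompactSupport (diffOp ξ φ) := hasCompactSupport_diffOp hφc
  have hLcont : Continuous (diffOp ξ φ) := continuous_diffOp hφ
  have hLint : Integrable (fun x => |diffOp ξ φ x|) μ :=
    (hLcont.integrable_of_hasCompactSupport hLc).abs
  set C := ∫ x, |diffOp ξ φ x| ∂μ with hC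
  have hC0 : 0 ≤ C := integral_nonneg fun x => abs_nonneg _
  have key : ∀ η : ℝ, 0 < η → -(η * C) ≤ ∫ x, u x * diffOp ξ φ x ∂μ := by
    intro η hη
    obtain ⟨g, hg, hgK⟩ := h (tsupport φ) hφΩ hφc η hη
    have h1 : 0 ≤ ∫ x, g x * diffOp ξ φ x ∂μ := by
      rw [integral_mul_diffOp hg hφ hφc]
      refine integral_nonneg fun x => ?_
      by_cases hx : x ∈ tsupport φ
      · exact mul_nonneg (hgK x hx).2 (hφ0 x)
      · simp [image_eq_zero_of_notMem_tsupport hx]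
    have h2 : ∫ x, (g x * diffOp ξ φ x - η * |diffOp ξ φ x|) ∂μ
        ≤ ∫ x, u x * diffOp ξ φ x ∂μ := by
      refine integral_mono ?_ (integrable_mul_of_tsupport_subset hΩ hu hLcont hLc
        ((tsupport_diffOp_subset φ).trans hφΩ)) fun x => ?_
      · exact ((hg.continuous.mul hLcont).integrable_of_hasCompactSupport hLc.mul_left).sub
          (hLint.const_mul η)
      · by_cases hx : x ∈ tsupport φ
        · have h3 : (g x - u x) * diffOp ξ φ x ≤ η * |diffOp ξ φ x| := by
            refine (le_abs_self _).trans ?_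
            rw [abs_mul]
            exact mul_le_mul_of_nonneg_right (hgK x hx).1 (abs_nonneg _)
          simp only
          linarith
        · have : diffOp ξ φ x = 0 := by
            by_contra hne
            exact hx (support_diffOp_subset φ hne)
          simp [this]
    have hgi : Integrable (fun x => g x * diffOp ξ φ x) μ :=
      (hg.continuous.mul hLcont).integrable_of_hasCompactSupport hLc.mul_left
    rw [integral_sub hgi (hLint.const_mul η), integral_const_mul] at h2
    linarith
  by_contra hneg
  rw [not_le] at hneg
  have := key (-(∫ x, u x * diffOp ξ φ x ∂μ) / (2 * (C + 1)))
    (div_pos (by linarith) (by linarith))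
  set I := ∫ x, u x * diffOp ξ φ x ∂μ with hI
  have h4 : -I / (2 * (C + 1)) * C ≤ -I / 2 := by
    rw [div_mul_eq_mul_div, div_le_div_iff₀ (by linarith) (by norm_num)]
    nlinarith
  linarith

/-- All derivatives fall on `ρ`, and reflection does not change second derivatives; the value at `x`
is thus `f` tested against `t ↦ ρ (x - t)`. -/
theorem diffOp_convolution {f ρ : E → ℝ} (hf : Continuous f) (hρ : ContDiff ℝ (⊤ : ℕ∞) ρ)
    (hρc : HasCompactSupport ρ) (x : E) :
    ContDiff ℝ (⊤ : ℕ∞) (convolution f ρ (ContinuousLinearMap.mul ℝ ℝ) μ) ∧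
    diffOp ξ (convolution f ρ (ContinuousLinearMap.mul ℝ ℝ) μ) x
      = ∫ t, f t * diffOp ξ (fun t => ρ (x - t)) t ∂μ := by
  have hsm := hρc.contDiff_convolution_right (n := ⊤) (ContinuousLinearMap.mul ℝ ℝ)
    (hf.locallyIntegrable (μ := μ)) hρ
  have hd : ∀ (a : E) (σ : E → ℝ), ContDiff ℝ (⊤ : ℕ∞) σ → HasCompactSupport σ →
      dirDeriv a (convolution f σ (ContinuousLinearMap.mul ℝ ℝ) μ)
        = convolution f (dirDeriv a σ) (ContinuousLinearMap.mul ℝ ℝ) μ := by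
    intro a σ hσ hσc
    funext y
    unfold dirDeriv
    rw [(hσc.hasFDerivAt_convolution_right _ hf.locallyIntegrable (hσ.of_le (by simp)) y).fderiv,
      convolution_precompR_apply _ hf.locallyIntegrable (hσc.fderiv ℝ)
        (hσ.continuous_fderiv (by simp))]
  refine ⟨hsm, ?_⟩
  have hc1 : ∀ a, HasCompactSupport (dirDeriv a ρ) := fun a => hρc.fderiv_apply ℝ a
  have hc2 : ∀ a, HasCompactSupport (dirDeriv a (dirDeriv a ρ)) := fun a =>
    (hc1 a).fderiv_apply ℝ a
  have hi : ∀ a, Integrable (fun t => f t * dirDeriv a (dirDeriv a ρ) (x - t)) μ := by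
    intro a
    refine (hf.mul ((contDiff_dirDeriv (contDiff_dirDeriv hρ a) a).continuous.comp
      (continuous_const.sub continuous_id))).integrable_of_hasCompactSupport ?_
    exact HasCompactSupport.mul_left ((hc2 a).comp_homeomorph (Homeomorph.subLeft x))
  simp only [diffOp_comp_const_sub hρ, diffOp_eq hsm, diffOp_eq hρ, Finset.mul_sum]
  rw [integral_finsetSum _ fun l _ => hi (ξ l)]
  refine Finset.sum_congr rfl fun l _ => ?_
  rw [hd _ _ hρ hρc, hd _ _ (contDiff_dirDeriv hρ _) (hc1 _)]
  rfl

/-- A continuous function which is locally a weak subsolution can be approximated by smooth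
subsolutions. -/
theorem isApproxSubsolution_of_locally {Ω : Set E} {u : E → ℝ}
    (hu : ContinuousOn u Ω)
    (h : ∀ x ∈ Ω, ∃ U : Set E, IsOpen U ∧ x ∈ U ∧ U ⊆ Ω ∧ IsWeakSubsolution μ ξ U u) :
    IsApproxSubsolution ξ Ω u := by
  intro K hK hKc η hη
  choose! U hUo hxU hUΩ hUu using h
  -- Below the Lebesgue number, every translated bump centred in `K` is supported in a single `U y`,
  -- so no partition of unity is needed.
  obtain ⟨δ, hδ, hball⟩ := lebesgue_number_lemma_of_metric hKc
    (c := fun x : Ω => U x) (fun x => hUo x x.2) fun x hx =>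
      Set.mem_iUnion.mpr ⟨⟨x, hK hx⟩, hxU x (hK hx)⟩
  set K' := Metric.cthickening (δ / 2) K with hK'
  have hK'c : IsCompact K' := hKc.cthickening
  have hK'Ω : K' ⊆ Ω := by
    rw [hK', hKc.cthickening_eq_biUnion_closedBall (by positivity)]
    refine Set.iUnion₂_subset fun x hx => ?_
    obtain ⟨y, hy⟩ := hball x hx
    exact (Metric.closedBall_subset_ball (by linarith)).trans (hy.trans (hUΩ y y.2))
  have huK' : ContinuousOn u K' := hu.mono hK'Ω
  -- Tietze extension: the convolution needs a globally continuous function, but at points of `K`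
  -- only its values on `K'` enter.
  obtain ⟨v, hv⟩ := ContinuousMap.exists_restrict_eq hK'c.isClosed
    (⟨K'.domRestrict u, huK'.domRestrict⟩ : C(K', ℝ))
  have hvu : ∀ x ∈ K', v x = u x := fun x hx => by
    exact congrArg (fun w : C(K', ℝ) => w ⟨x, hx⟩) hv
  obtain ⟨δ', hδ', hunif⟩ := Metric.uniformContinuousOn_iff.mp
    (hK'c.uniformContinuousOn_of_continuous huK') η hη
  set r := min (δ / 2) δ' with hr
  have hr0 : 0 < r := lt_min (by positivity) hδ'
  set ρ : ContDiffBump (0 : E) := ⟨r / 2, r, by positivity, by linarith⟩ with hρ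
  have hclosed : ∀ x ∈ K, Metric.closedBall x r ⊆ K' := fun x hx =>
    (Metric.closedBall_subset_closedBall (min_le_left _ _)).trans
      (Metric.closedBall_subset_cthickening hx _)
  have hL := fun x => diffOp_convolution (ξ := ξ) (μ := μ) v.continuous
    (ρ.contDiff_normed (μ := μ)) ρ.hasCompactSupport_normed x
  refine ⟨_, (hL 0).1, fun x hx => ⟨?_, ?_⟩⟩
  · have h1 : convolution v (ρ.normed μ) (ContinuousLinearMap.mul ℝ ℝ) μ x
        = convolution (ρ.normed μ) v (ContinuousLinearMap.lsmul ℝ ℝ) μ x := by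
      rw [convolution_lsmul_swap]
      unfold convolution
      refine integral_congr_ae (Filter.Eventually.of_forall fun t => ?_)
      simp [mul_comm]
    have hxK' : x ∈ K' := hclosed x hx (Metric.mem_closedBall_self hr0.le)
    rw [h1, ← hvu x hxK', ← Real.dist_eq]
    refine ρ.dist_normed_convolution_le v.continuous.aestronglyMeasurable fun y hy => ?_
    have hyr : dist y x < r := hy
    have hyK' : y ∈ K' := hclosed x hx hyr.le
    rw [hvu x hxK', hvu y hyK']
    exact (hunif y hyK' x hxK' (hyr.trans_le (min_le_right _ _))).le
  · rw [(hL x).2]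
    have hts : tsupport (fun t => ρ.normed μ (x - t)) ⊆ Metric.closedBall x r := by
      refine closure_minimal (fun t ht => ?_) Metric.isClosed_closedBall
      have : x - t ∈ Metric.ball (0 : E) r := by
        rw [← show Function.support (ρ.normed μ) = _ from ρ.support_normed_eq]
        exact ht
      rw [Metric.mem_closedBall, dist_comm, dist_eq_norm]
      exact (mem_ball_zero_iff.mp this).le
    obtain ⟨y, hy⟩ := hball x hx
    have hrδ : r < δ := (min_le_left _ _).trans_lt (by linarith)
    have h2 := hUu y y.2 (fun t => ρ.normed μ (x - t)) (contDiff_comp_const_sub ρ.contDiff_normed x)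
      (ρ.hasCompactSupport_normed.comp_homeomorph (Homeomorph.subLeft x))
      (hts.trans ((Metric.closedBall_subset_ball hrδ).trans hy)) fun t => ρ.nonneg_normed _
    refine h2.trans_eq (integral_congr_ae (Filter.Eventually.of_forall fun t => ?_))
    by_cases ht : t ∈ Metric.closedBall x r
    · simp only [hvu t (hclosed x hx ht)]
    · have : diffOp ξ (fun t => ρ.normed μ (x - t)) t = 0 := by
        by_contra hne
        exact ht (hts (support_diffOp_subset _ hne))
      simp [this]

end Subsolutions

/-! ### Edwards' theorem for cones of continuous functions -/

section Edwards

set_option linter.unusedSectionVars false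

variable {E : Type*} [TopologicalSpace E] [T2Space E] [MeasurableSpace E] [BorelSpace E]

theorem setIntegral_eq_integral_of_compl_null {X : Set E} {μ : Measure E} (h : μ Xᶜ = 0)
    (f : E → ℝ) : ∫ x in X, f x ∂μ = ∫ x, f x ∂μ := by
  rw [Measure.restrict_eq_self_of_ae_mem]
  rw [ae_iff]
  exact h

/-- Riesz representation of a normalized positive functional on the continuous functions on a
compact set. -/
theorem exists_measure_of_positive {X : Set E} (hX : IsCompact X) (Λ : C(X, ℝ) →ₗ[ℝ] ℝ)
    (hpos : ∀ g : C(X, ℝ), 0 ≤ g → 0 ≤ Λ g) (hone : Λ 1 = 1) :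
    ∃ μ : Measure E, IsProbabilityMeasure μ ∧ μ Xᶜ = 0 ∧
      ∀ (v : E → ℝ) (hv : ContinuousOn v X), ∫ x in X, v x ∂μ = Λ ⟨X.domRestrict v, hv.domRestrict⟩ := by
  have hc : CompactSpace X := isCompact_iff_compactSpace.mp hX
  let Λ' : CompactlySupportedContinuousMap X ℝ →ₚ[ℝ] ℝ := PositiveLinearMap.mk₀
    { toFun := fun f => Λ f.toContinuousMap
      map_add' := fun f g => Λ.map_add f.toContinuousMap g.toContinuousMap
      map_smul' := fun c f => Λ.map_smul c f.toContinuousMap }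
    fun f hf => hpos f.toContinuousMap hf
  set ν := RealRMK.rieszMeasure Λ' with hν
  have hint : ∀ g : C(X, ℝ), ∫ x, g x ∂ν = Λ g := fun g =>
    RealRMK.integral_rieszMeasure Λ' (CompactlySupportedContinuousMap.continuousMapEquiv g)
  have hmass : ν Set.univ = 1 := by
    have h1 := hint 1
    simp only [ContinuousMap.one_apply, integral_const, smul_eq_mul, mul_one, hone] at h1
    rwa [measureReal_def, ENNReal.toReal_eq_one_iff] at h1
  have hemb : MeasurableEmbedding (Subtype.val : X → E) :=
    MeasurableEmbedding.subtype_coe hX.isClosed.measurableSet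
  have hnull : (ν.map Subtype.val) Xᶜ = 0 := by
    rw [hemb.map_apply]
    simp
  refine ⟨ν.map Subtype.val, ⟨?_⟩, hnull, fun v hv => ?_⟩
  · rw [hemb.map_apply, Set.preimage_univ, hmass]
  · rw [setIntegral_eq_integral_of_compl_null hnull, hemb.integral_map, ← hint]
    rfl

/-- A convex cone of functions which are continuous on `X`, containing the constants. -/
structure IsFunctionCone (X : Set E) (F : Set (E → ℝ)) : Prop where
  continuousOn : ∀ v ∈ F, ContinuousOn v X
  add_mem : ∀ v ∈ F, ∀ w ∈ F, (fun x => v x + w x) ∈ F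
  mul_mem : ∀ c : ℝ, 0 < c → ∀ v ∈ F, (fun x => c * v x) ∈ F
  const_mem : ∀ c : ℝ, (fun _ => c) ∈ F

/-- Edwards' theorem for a continuous function which satisfies the Jensen inequality at `z`. -/
theorem IsFunctionCone.exists_le_of_jensen {X : Set E} (hX : IsCompact X) {F : Set (E → ℝ)}
    (hF : IsFunctionCone X F) {u : E → ℝ} (hu : ContinuousOn u X) {z : E} (hz : z ∈ X)
    (hJ : ∀ μ : Measure E, IsProbabilityMeasure μ → μ Xᶜ = 0 →
      (∀ v ∈ F, v z ≤ ∫ x in X, v x ∂μ) → u z ≤ ∫ x in X, u x ∂μ) {ε : ℝ} (hε : 0 < ε) :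
    ∃ v ∈ F, (∀ x ∈ X, v x ≤ u x) ∧ u z - ε ≤ v z := by
  have hc : CompactSpace X := isCompact_iff_compactSpace.mp hX
  -- `N g = inf S g` is sublinear, and `-N (-u)` is the supremum of `v z` over `v ∈ F` with `v ≤ u`.
  -- A linear `Λ ≤ N` with equality at `-u` will be a Jensen measure that attains this supremum.
  let S : C(X, ℝ) → Set ℝ := fun g => {r | ∃ v ∈ F, (∀ x : X, g x ≤ -v x) ∧ r = -v z}
  let N : C(X, ℝ) → ℝ := fun g => sInf (S g)
  let z' : X := ⟨z, hz⟩
  have hbdd : ∀ g, BddBelow (S g) := by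
    refine fun g => ⟨g z', ?_⟩
    rintro r ⟨v, -, hv, rfl⟩
    exact hv z'
  have hne : ∀ g, (S g).Nonempty := by
    intro g
    refine ⟨_, fun _ => -‖g‖, hF.const_mem _, fun x => ?_, rfl⟩
    simpa using (le_abs_self _).trans (g.norm_coe_le_norm x)
  have hNle : ∀ (g : C(X, ℝ)) (v : E → ℝ), v ∈ F → (∀ x : X, g x ≤ -v x) → N g ≤ -v z :=
    fun g v hv h => csInf_le (hbdd g) ⟨v, hv, h, rfl⟩
  have hleN : ∀ (g : C(X, ℝ)) (b : ℝ),
      (∀ v ∈ F, (∀ x : X, g x ≤ -v x) → b ≤ -v z) → b ≤ N g := by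
    intro g b h
    refine le_csInf (hne g) ?_
    rintro r ⟨v, hv, hvg, rfl⟩
    exact h v hv hvg
  have hNz : ∀ g, g z' ≤ N g := fun g => hleN g _ fun v _ h => h z'
  have hsub : ∀ g h, N (g + h) ≤ N g + N h := by
    intro g h
    rw [← sub_le_iff_le_add]
    refine hleN g _ fun v hv hvg => ?_
    rw [sub_le_iff_le_add, ← sub_le_iff_le_add']
    refine hleN h _ fun w hw hwh => ?_
    rw [sub_le_iff_le_add']
    refine (hNle (g + h) _ (hF.add_mem v hv w hw) fun x => ?_).trans_eq (by ring)
    have := hvg x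
    have := hwh x
    simp only [ContinuousMap.add_apply]
    linarith
  have hhom1 : ∀ c : ℝ, 0 < c → ∀ g, N (c • g) ≤ c * N g := by
    intro c hc g
    rw [← div_le_iff₀' hc]
    refine hleN g _ fun v hv hvg => ?_
    rw [div_le_iff₀' hc]
    refine (hNle (c • g) _ (hF.mul_mem c hc v hv) fun x => ?_).trans_eq (by ring)
    have := mul_le_mul_of_nonneg_left (hvg x) hc.le
    simp only [ContinuousMap.smul_apply, smul_eq_mul]
    linarith
  have hhom : ∀ c : ℝ, 0 < c → ∀ g, N (c • g) = c * N g := by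
    intro c hc g
    refine le_antisymm (hhom1 c hc g) ?_
    have h1 := hhom1 c⁻¹ (inv_pos.mpr hc) (c • g)
    rw [smul_smul, inv_mul_cancel₀ hc.ne', one_smul] at h1
    have h2 := mul_le_mul_of_nonneg_left h1 hc.le
    rwa [← mul_assoc, mul_inv_cancel₀ hc.ne', one_mul] at h2
  have hN0 : N 0 = 0 := by
    refine le_antisymm ?_ (hNz 0)
    simpa using hNle 0 _ (hF.const_mem 0) fun x => by simp
  let g0 : C(X, ℝ) := -⟨X.domRestrict u, hu.domRestrict⟩
  have hg0 : ∀ x : X, g0 x = -u x := fun x => rfl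
  obtain ⟨Λ, hΛ0, hΛN⟩ : ∃ Λ : C(X, ℝ) →ₗ[ℝ] ℝ, Λ g0 = N g0 ∧ ∀ g, Λ g ≤ N g := by
    by_cases h0 : g0 = 0
    · obtain ⟨Λ, -, hΛ⟩ := exists_extension_of_le_sublinear (⊥ : C(X, ℝ) →ₗ.[ℝ] ℝ) N hhom hsub
        (by
          rintro ⟨x, hx⟩
          have : x = 0 := (Submodule.mem_bot ℝ).mp hx
          subst this
          rw [hN0]
          exact (LinearPMap.map_zero (⊥ : C(X, ℝ) →ₗ.[ℝ] ℝ)).le)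
      exact ⟨Λ, by rw [h0, map_zero, hN0], hΛ⟩
    · obtain ⟨Λ, hΛ1, hΛ⟩ := exists_extension_of_le_sublinear
        (LinearPMap.mkSpanSingleton g0 (N g0) h0) N hhom hsub (by
          rintro ⟨x, hx⟩
          obtain ⟨c, rfl⟩ := Submodule.mem_span_singleton.mp hx
          refine (LinearPMap.mkSpanSingleton'_apply g0 (N g0) _ c hx).trans_le ?_
          simp only [RingHom.id_apply, smul_eq_mul]
          -- For `c < 0` only `0 = N 0 ≤ N (c g0) + N (-c g0)` is available, and it suffices.
          rcases lt_trichotomy c 0 with hc | hc | hc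
          · have h1 := hsub (c • g0) ((-c) • g0)
            rw [← add_smul, add_neg_cancel, zero_smul, hN0, hhom (-c) (by linarith)] at h1
            linarith
          · rw [hc, zero_mul, zero_smul, hN0]
          · rw [hhom c hc])
      refine ⟨Λ, ?_, hΛ⟩
      exact (hΛ1 ⟨g0, Submodule.mem_span_singleton_self g0⟩).trans
        (LinearPMap.mkSpanSingleton_apply ℝ ℝ h0 (N g0))
  have hpos : ∀ g : C(X, ℝ), 0 ≤ g → 0 ≤ Λ g := by
    intro g hg
    have h1 := hΛN (-g)
    have h2 := hNle (-g) _ (hF.const_mem 0) fun x => by simpa using hg x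
    rw [map_neg] at h1
    linarith
  have hone : Λ 1 = 1 := by
    have h1 := (hΛN 1).trans (hNle 1 _ (hF.const_mem (-1)) fun x => by simp)
    have h2 := (hΛN (-1)).trans (hNle (-1) _ (hF.const_mem 1) fun x => by simp)
    rw [map_neg] at h2
    linarith
  obtain ⟨μ, hμ1, hμ2, hμ3⟩ := exists_measure_of_positive hX Λ hpos hone
  -- Indeed `Λ (-v) ≤ N (-v) ≤ -v z`, since `v` itself is admissible in the infimum.
  have hJen : ∀ v ∈ F, v z ≤ ∫ x in X, v x ∂μ := by
    intro v hv
    rw [hμ3 v (hF.continuousOn v hv)]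
    have h1 := hΛN (-⟨X.domRestrict v, (hF.continuousOn v hv).domRestrict⟩)
    have h2 := hNle (-⟨X.domRestrict v, (hF.continuousOn v hv).domRestrict⟩) v hv fun x => le_rfl
    rw [map_neg] at h1
    linarith
  have hfin := hJ μ hμ1 hμ2 hJen
  rw [hμ3 u hu] at hfin
  have hΛu : Λ ⟨X.domRestrict u, hu.domRestrict⟩ = -N g0 := by
    rw [← hΛ0, map_neg, neg_neg]
  obtain ⟨r, ⟨v, hv, hvg, rfl⟩, hr⟩ := Real.lt_sInf_add_pos (hne g0) hε
  have hr' : -v z < N g0 + ε := hr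
  refine ⟨v, hv, fun x hx => ?_, by linarith⟩
  have := hvg ⟨x, hx⟩
  rw [hg0] at this
  simp only at this
  linarith

/-- Uniform approximation from a max-stable cone of a continuous function which satisfies the
Jensen inequalities. -/
theorem IsFunctionCone.exists_uniform_approx {X : Set E} (hX : IsCompact X) {F : Set (E → ℝ)}
    (hF : IsFunctionCone X F) (hmax : ∀ v ∈ F, ∀ w ∈ F, (fun x => max (v x) (w x)) ∈ F)
    {u : E → ℝ} (hu : ContinuousOn u X)
    (hJ : ∀ z ∈ X, ∀ μ : Measure E, IsProbabilityMeasure μ → μ Xᶜ = 0 →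
      (∀ v ∈ F, v z ≤ ∫ x in X, v x ∂μ) → u z ≤ ∫ x in X, u x ∂μ) {ε : ℝ} (hε : 0 < ε) :
    ∃ v ∈ F, ∀ x ∈ X, |v x - u x| ≤ ε := by
  have key : ∃ v ∈ F, (∀ x ∈ X, v x ≤ u x) ∧ ∀ x ∈ X, u x - ε ≤ v x := by
    -- The bound `v ≤ u` is kept on all of `X`, so the maximum of two such minorants is again one
    -- and is good on the union.
    refine hX.induction_on (p := fun S => ∃ v ∈ F, (∀ x ∈ X, v x ≤ u x) ∧ ∀ x ∈ S, u x - ε ≤ v x)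
      ?_ ?_ ?_ ?_
    · obtain ⟨c, hc⟩ := hX.bddBelow_image hu
      exact ⟨fun _ => c, hF.const_mem c, fun x hx => hc (Set.mem_image_of_mem u hx), by simp⟩
    · rintro s t hst ⟨v, hv, h1, h2⟩
      exact ⟨v, hv, h1, fun x hx => h2 x (hst hx)⟩
    · rintro s t ⟨v, hv, h1, h2⟩ ⟨w, hw, h3, h4⟩
      refine ⟨_, hmax v hv w hw, fun x hx => max_le (h1 x hx) (h3 x hx), ?_⟩
      rintro x (hx | hx)
      · exact (h2 x hx).trans (le_max_left _ _)
      · exact (h4 x hx).trans (le_max_right _ _)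
    · intro z hz
      obtain ⟨v, hv, h1, h2⟩ := hF.exists_le_of_jensen hX hu hz (hJ z hz) (half_pos hε)
      have hcont : ContinuousWithinAt (fun x => v x - u x) X z :=
        (hF.continuousOn v hv z hz).sub (hu z hz)
      have hev : ∀ᶠ x in 𝓝[X] z, -ε < v x - u x :=
        hcont.eventually (lt_mem_nhds (by linarith))
      exact ⟨_, hev, v, hv, h1, fun x hx => by
        have : -ε < v x - u x := hx
        linarith⟩
  obtain ⟨v, hv, h1, h2⟩ := key
  refine ⟨v, hv, fun x hx => abs_le.mpr ⟨?_, ?_⟩⟩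
  · linarith [h2 x hx]
  · linarith [h1 x hx]

end Edwards

/-! ### Stability of m-subharmonicity, restriction and gluing -/

section Compact

variable {n m : ℕ}

/-- Sums, maxima and localization are easy for approximable functions. Quantifying over all `ξ` that
represent the operator lets two functions be approximated with the same `ξ`. -/
theorem contMSubharmonicOn_iff_isApproxSubsolution (hm : 1 ≤ m) (hmn : m ≤ n) {Ω : Set (Cn n)}
    (hΩ : IsOpen Ω) {u : Cn n → ℝ} :
    ContMSubharmonicOn m Ω u ↔ ContinuousOn u Ω ∧
      ∀ A : ℕ → Matrix (Fin n) (Fin n) ℂ, (∀ i, A i ∈ Gamma n m) →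
        ∀ ξ : Fin n ⊕ Fin n → Cn n,
          (∀ φ z, mWedge m (complexHessian φ z) A = diffOp ξ φ z) →
            IsApproxSubsolution ξ Ω u := by
  refine and_congr_right fun hu => ⟨fun h A hA ξ hξ => ?_, fun h A hA => ?_⟩
  · refine isApproxSubsolution_of_locally (μ := volume) hu fun x hx =>
      ⟨Ω, hΩ, hx, subset_rfl, fun φ h1 h2 h3 h4 => ?_⟩
    simpa only [hξ] using h A hA φ h1 h2 h3 h4
  · obtain ⟨ξ, hξ⟩ := exists_directions hm hmn hA
    intro φ h1 h2 h3 h4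
    have h5 := (h A hA ξ hξ).isWeakSubsolution (μ := volume) hΩ hu φ h1 h2 h3 h4
    have h6 : ∀ z, mWedge m (complexHessian φ z) A = diffOp ξ φ z := hξ φ
    simpa only [h6] using h5

theorem contMSubharmonicOn_of_locally (hm : 1 ≤ m) (hmn : m ≤ n) {Ω : Set (Cn n)}
    {u : Cn n → ℝ} (h : ∀ x ∈ Ω, ∃ U : Set (Cn n), IsOpen U ∧ x ∈ U ∧ U ⊆ Ω ∧
      ContMSubharmonicOn m U u) (hΩ : IsOpen Ω) : ContMSubharmonicOn m Ω u := by
  have hu : ContinuousOn u Ω := by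
    intro x hx
    obtain ⟨U, hU, hxU, -, hUu⟩ := h x hx
    exact (hUu.1.continuousAt (hU.mem_nhds hxU)).continuousWithinAt
  rw [contMSubharmonicOn_iff_isApproxSubsolution hm hmn hΩ]
  refine ⟨hu, fun A hA ξ hξ => isApproxSubsolution_of_locally (μ := volume) hu fun x hx => ?_⟩
  obtain ⟨U, hU, hxU, hUΩ, hUu⟩ := h x hx
  rw [contMSubharmonicOn_iff_isApproxSubsolution hm hmn hU] at hUu
  exact ⟨U, hU, hxU, hUΩ, (hUu.2 A hA ξ hξ).isWeakSubsolution hU hUu.1⟩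

theorem ContMSubharmonicOn.mono {Ω Ω' : Set (Cn n)} {u : Cn n → ℝ}
    (h : ContMSubharmonicOn m Ω u) (hs : Ω' ⊆ Ω) : ContMSubharmonicOn m Ω' u :=
  ⟨h.1.mono hs, fun A hA φ h1 h2 h3 h4 => h.2 A hA φ h1 h2 (h3.trans hs) h4⟩

theorem ContMSubharmonicOn.congr (hm : 1 ≤ m) (hmn : m ≤ n) {Ω : Set (Cn n)} (hΩ : IsOpen Ω)
    {u v : Cn n → ℝ} (h : ContMSubharmonicOn m Ω u) (huv : Set.EqOn v u Ω) :
    ContMSubharmonicOn m Ω v := by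
  rw [contMSubharmonicOn_iff_isApproxSubsolution hm hmn hΩ] at h ⊢
  refine ⟨h.1.congr huv, fun A hA ξ hξ K hK hKc η hη => ?_⟩
  obtain ⟨g, hg, hgK⟩ := h.2 A hA ξ hξ K hK hKc η hη
  exact ⟨g, hg, fun x hx => by rw [huv (hK hx)]; exact hgK x hx⟩

theorem ContMSubharmonicOn.sup (hm : 1 ≤ m) (hmn : m ≤ n) {Ω : Set (Cn n)} (hΩ : IsOpen Ω)
    {u v : Cn n → ℝ} (hu : ContMSubharmonicOn m Ω u) (hv : ContMSubharmonicOn m Ω v) :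
    ContMSubharmonicOn m Ω (fun x => max (u x) (v x)) := by
  rw [contMSubharmonicOn_iff_isApproxSubsolution hm hmn hΩ] at hu hv ⊢
  exact ⟨hu.1.sup hv.1, fun A hA ξ hξ => (hu.2 A hA ξ hξ).sup (hv.2 A hA ξ hξ)⟩

theorem ContMSubharmonicOn.add (hm : 1 ≤ m) (hmn : m ≤ n) {Ω : Set (Cn n)} (hΩ : IsOpen Ω)
    {u v : Cn n → ℝ} (hu : ContMSubharmonicOn m Ω u) (hv : ContMSubharmonicOn m Ω v) :
    ContMSubharmonicOn m Ω (fun x => u x + v x) := by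
  rw [contMSubharmonicOn_iff_isApproxSubsolution hm hmn hΩ] at hu hv ⊢
  exact ⟨hu.1.add hv.1, fun A hA ξ hξ => (hu.2 A hA ξ hξ).add (hv.2 A hA ξ hξ)⟩

theorem ContMSubharmonicOn.const_mul (hm : 1 ≤ m) (hmn : m ≤ n) {Ω : Set (Cn n)}
    (hΩ : IsOpen Ω) {u : Cn n → ℝ} (hu : ContMSubharmonicOn m Ω u) {c : ℝ} (hc : 0 ≤ c) :
    ContMSubharmonicOn m Ω (fun x => c * u x) := by
  rw [contMSubharmonicOn_iff_isApproxSubsolution hm hmn hΩ] at hu ⊢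
  exact ⟨continuousOn_const.mul hu.1, fun A hA ξ hξ => (hu.2 A hA ξ hξ).const_mul hc⟩

theorem contMSubharmonicOn_affine (hm : 1 ≤ m) (hmn : m ≤ n) {Ω : Set (Cn n)} (hΩ : IsOpen Ω)
    (L : Cn n →L[ℝ] ℝ) (c : ℝ) : ContMSubharmonicOn m Ω (fun x => L x + c) := by
  have hs : ContDiff ℝ (⊤ : ℕ∞) fun x => L x + c := L.contDiff.add contDiff_const
  rw [contMSubharmonicOn_iff_isApproxSubsolution hm hmn hΩ]
  refine ⟨hs.continuous.continuousOn, fun A _ ξ _ =>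
    isApproxSubsolution_of_contDiff hs fun x => ?_⟩
  have h1 : fderiv ℝ (fun x => L x + c) = fun _ => L := by
    funext y
    rw [fderiv_add_const]
    exact L.fderiv
  simp [diffOp, h1]

theorem contMSubharmonicOn_const (hm : 1 ≤ m) (hmn : m ≤ n) {Ω : Set (Cn n)} (hΩ : IsOpen Ω)
    (c : ℝ) : ContMSubharmonicOn m Ω (fun _ => c) := by
  simpa using contMSubharmonicOn_affine hm hmn hΩ 0 c

theorem ContMSubharmonicOn.finset_sup' (hm : 1 ≤ m) (hmn : m ≤ n) {Ω : Set (Cn n)}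
    (hΩ : IsOpen Ω) {ι : Type*} {s : Finset ι} (hs : s.Nonempty) {w : ι → Cn n → ℝ}
    (hw : ∀ i ∈ s, ContMSubharmonicOn m Ω (w i)) :
    ContMSubharmonicOn m Ω (fun x => s.sup' hs fun i => w i x) := by
  have h := Finset.sup'_induction (p := ContMSubharmonicOn m Ω) hs w
    (fun u hu v hv => hu.sup hm hmn hΩ hv) hw
  have h2 : s.sup' hs w = fun x => s.sup' hs fun i => w i x := by
    funext x
    rw [Finset.sup'_apply]
  rwa [h2] at h

theorem isFunctionCone_SHo (hm : 1 ≤ m) (hmn : m ≤ n) (X : Set (Cn n)) :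
    IsFunctionCone X (SHo m X) where
  continuousOn := by
    rintro v ⟨Ω, w, -, hXΩ, hw, hvw⟩
    exact (hw.1.mono hXΩ).congr hvw
  add_mem := by
    rintro v ⟨Ω, w, hΩ, hXΩ, hw, hvw⟩ v' ⟨Ω', w', hΩ', hXΩ', hw', hvw'⟩
    refine ⟨Ω ∩ Ω', _, hΩ.inter hΩ', Set.subset_inter hXΩ hXΩ',
      (hw.mono Set.inter_subset_left).add hm hmn (hΩ.inter hΩ')
        (hw'.mono Set.inter_subset_right), fun x hx => ?_⟩
    simp only [hvw hx, hvw' hx]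
  mul_mem := by
    rintro c hc v ⟨Ω, w, hΩ, hXΩ, hw, hvw⟩
    exact ⟨Ω, _, hΩ, hXΩ, hw.const_mul hm hmn hΩ hc.le, fun x hx => by simp only [hvw hx]⟩
  const_mem c := ⟨Set.univ, _, isOpen_univ, Set.subset_univ X,
    contMSubharmonicOn_const hm hmn isOpen_univ c, fun _ _ => rfl⟩

theorem sup_mem_SHo (hm : 1 ≤ m) (hmn : m ≤ n) {X : Set (Cn n)} {v v' : Cn n → ℝ}
    (hv : v ∈ SHo m X) (hv' : v' ∈ SHo m X) : (fun x => max (v x) (v' x)) ∈ SHo m X := by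
  obtain ⟨Ω, w, hΩ, hXΩ, hw, hvw⟩ := hv
  obtain ⟨Ω', w', hΩ', hXΩ', hw', hvw'⟩ := hv'
  refine ⟨Ω ∩ Ω', _, hΩ.inter hΩ', Set.subset_inter hXΩ hXΩ',
    (hw.mono Set.inter_subset_left).sup hm hmn (hΩ.inter hΩ')
      (hw'.mono Set.inter_subset_right), fun x hx => ?_⟩
  simp only [hvw hx, hvw' hx]

theorem extIntegral_coe {X : Set (Cn n)} (hX : IsCompact X) {u : Cn n → ℝ}
    (hu : ContinuousOn u X) (μ : Measure (Cn n)) [IsProbabilityMeasure μ] :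
    extIntegral μ X (fun x => (u x : EReal)) = ((∫ x in X, u x ∂μ : ℝ) : EReal) := by
  have hi : Integrable u (μ.restrict X) := hu.integrableOn_compact hX
  have h1 : ∫⁻ x in X, ENNReal.ofReal (u x) ∂μ ≠ ⊤ := hi.lintegral_lt_top.ne
  have h2 : ∫⁻ x in X, ENNReal.ofReal (-u x) ∂μ ≠ ⊤ := hi.neg.lintegral_lt_top.ne
  unfold extIntegral
  rw [integral_eq_lintegral_pos_part_sub_lintegral_neg_part hi, EReal.coe_sub,
    EReal.coe_ennreal_toReal h1, EReal.coe_ennreal_toReal h2]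
  simp only [← EReal.coe_neg, EReal.real_coe_toENNReal]

theorem memSHInterC_iff {X : Set (Cn n)} (hX : IsCompact X) {u : Cn n → ℝ} :
    MemSHInterC m X u ↔ ContinuousOn u X ∧
      ∀ z ∈ X, ∀ μ ∈ JensenMeasures m X z, u z ≤ ∫ x in X, u x ∂μ := by
  constructor
  · rintro ⟨⟨-, -, h⟩, hu⟩
    refine ⟨hu, fun z hz μ hμ => ?_⟩
    have := hμ.1
    have h1 := h z hz μ hμ
    rw [extIntegral_coe hX hu μ] at h1
    exact EReal.coe_le_coe_iff.mp h1
  · rintro ⟨hu, h⟩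
    refine ⟨⟨?_, fun z _ => EReal.coe_ne_top _, fun z hz μ hμ => ?_⟩, hu⟩
    · exact (continuous_coe_real_ereal.comp_continuousOn hu).upperSemicontinuousOn
    · have := hμ.1
      rw [extIntegral_coe hX hu μ]
      exact EReal.coe_le_coe_iff.mpr (h z hz μ hμ)

/-- A neighbourhood of `X` is one of `Y`, so `SHo m X ⊆ SHo m Y` and a Jensen measure on `Y` is one
on `X`, with the same integrals. -/
theorem MemSHInterC.mono {X Y : Set (Cn n)} (hX : IsCompact X) (hY : IsCompact Y) (hYX : Y ⊆ X)
    {u : Cn n → ℝ} (h : MemSHInterC m X u) : MemSHInterC m Y u := by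
  rw [memSHInterC_iff hX] at h
  rw [memSHInterC_iff hY]
  refine ⟨h.1.mono hYX, fun z hz μ hμ => ?_⟩
  obtain ⟨hμ1, hμY, hμJ⟩ := hμ
  have hμX : μ Xᶜ = 0 := measure_mono_null (Set.compl_subset_compl.mpr hYX) hμY
  have h1 := h.2 z (hYX hz) μ ⟨hμ1, hμX, fun v hv => ?_⟩
  · rwa [setIntegral_eq_integral_of_compl_null hμX,
      ← setIntegral_eq_integral_of_compl_null hμY] at h1
  · obtain ⟨Ω, w, hΩ, hXΩ, hw, hvw⟩ := hv
    have h2 := hμJ v ⟨Ω, w, hΩ, hYX.trans hXΩ, hw, hvw.mono hYX⟩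
    rwa [setIntegral_eq_integral_of_compl_null hμY,
      ← setIntegral_eq_integral_of_compl_null hμX] at h2

theorem MemSHInterC.exists_uniform_approx (hm : 1 ≤ m) (hmn : m ≤ n) {X : Set (Cn n)}
    (hX : IsCompact X) {u : Cn n → ℝ} (h : MemSHInterC m X u) {ε : ℝ} (hε : 0 < ε) :
    ∃ (Ω : Set (Cn n)) (w : Cn n → ℝ), IsOpen Ω ∧ X ⊆ Ω ∧ ContMSubharmonicOn m Ω w ∧
      ∀ x ∈ X, |w x - u x| ≤ ε := by
  rw [memSHInterC_iff hX] at h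
  obtain ⟨v, ⟨Ω, w, hΩ, hXΩ, hw, hvw⟩, hv⟩ := (isFunctionCone_SHo hm hmn X).exists_uniform_approx hX
    (fun v hv w hw => sup_mem_SHo hm hmn hv hw) h.1
    (fun z hz μ h1 h2 h3 => h.2 z hz μ ⟨h1, h2, h3⟩) hε
  exact ⟨Ω, w, hΩ, hXΩ, hw, fun x hx => hvw hx ▸ hv x hx⟩

/-- Gluing of local approximants: the corrections `‖x‖² - ‖x - z‖²` are affine, and make the
approximant with the nearest centre dominate. -/
theorem exists_mem_SHo_of_local_approx (hm : 1 ≤ m) (hmn : m ≤ n) {X : Set (Cn n)}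
    {u : Cn n → ℝ} {t : Finset (Cn n)} {r η δ M : ℝ} (hr : 0 < r) (hη : 0 < η)
    (hδη : 2 * δ < η * (3 / 4 * r ^ 2)) (ht : ∀ x ∈ X, ∃ z ∈ t, dist x z < r / 2)
    {Ω : Cn n → Set (Cn n)} {w : Cn n → Cn n → ℝ} (hΩ : ∀ z ∈ t, IsOpen (Ω z))
    (hXΩ : ∀ z ∈ t, X ∩ Metric.closedBall z r ⊆ Ω z)
    (hw : ∀ z ∈ t, ContMSubharmonicOn m (Ω z) (w z))
    (hwu : ∀ z ∈ t, ∀ x ∈ X ∩ Metric.closedBall z r, |w z x - u x| ≤ δ)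
    (hM : ∀ z ∈ t, ∀ x ∈ X, dist x z < r → |‖x‖ ^ 2 - dist x z ^ 2| ≤ M) :
    ∃ v ∈ SHo m X, ∀ x ∈ X, |v x - u x| ≤ δ + η * M := by
  classical
  set W : Cn n → Cn n → ℝ := fun z x => w z x + η * (‖x‖ ^ 2 - dist x z ^ 2) with hW
  have hWsub : ∀ z ∈ t, ContMSubharmonicOn m (Ω z) (W z) := by
    intro z hz
    -- `‖x‖² - ‖x - z‖² = 2 Re ⟨z, x⟩ - ‖z‖²`.
    have haff := (contMSubharmonicOn_affine hm hmn (hΩ z hz)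
      ((2 : ℝ) • Complex.reCLM.comp ((innerSL ℂ z).restrictScalars ℝ)) (-‖z‖ ^ 2)).const_mul
        hm hmn (hΩ z hz) hη.le
    refine ((hw z hz).add hm hmn (hΩ z hz) haff).congr hm hmn (hΩ z hz) fun x _ => ?_
    simp only [hW]
    rw [dist_comm, dist_eq_norm, norm_sub_sq (𝕜 := ℂ)]
    simp
    left
    ring
  set F : Cn n → Finset (Cn n) := fun x => t.filter fun z => dist x z < r with hF
  have hFne : ∀ x ∈ X, (F x).Nonempty := by
    intro x hx
    obtain ⟨z, hz, hxz⟩ := ht x hx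
    exact ⟨z, Finset.mem_filter.mpr ⟨hz, by linarith⟩⟩
  -- The value `0` is never met near `X`, where some centre is always within `r`.
  set v : Cn n → ℝ := fun x =>
    if h : (F x).Nonempty then (F x).sup' h fun z => W z x else 0 with hv
  have hWu : ∀ x ∈ X, ∀ z ∈ F x, |W z x - u x| ≤ δ + η * M := by
    intro x hx z hz
    obtain ⟨hzt, hxz⟩ := Finset.mem_filter.mp hz
    have h1 := hwu z hzt x ⟨hx, hxz.le⟩
    have h2 := mul_le_mul_of_nonneg_left (hM z hzt x hx hxz) hη.le
    have h3 := abs_add_le (w z x - u x) (η * (‖x‖ ^ 2 - dist x z ^ 2))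
    rw [abs_mul, abs_of_pos hη] at h3
    rw [show W z x - u x = w z x - u x + η * (‖x‖ ^ 2 - dist x z ^ 2) by simp only [hW]; ring]
    linarith
  have hlocal : ∀ x₀ ∈ X, ∃ U : Set (Cn n), IsOpen U ∧ x₀ ∈ U ∧ ContMSubharmonicOn m U v := by
    intro x₀ hx₀
    have hJ := hFne x₀ hx₀
    obtain ⟨z₀, hz₀, hxz₀⟩ := ht x₀ hx₀
    have hz₀F : z₀ ∈ F x₀ := Finset.mem_filter.mpr ⟨hz₀, by linarith⟩
    have hWc : ∀ z ∈ t, x₀ ∈ Metric.closedBall z r → ContinuousAt (W z) x₀ := fun z hz hxz =>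
      (hWsub z hz).1.continuousAt ((hΩ z hz).mem_nhds (hXΩ z hz ⟨hx₀, hxz⟩))
    have hz₀c : x₀ ∈ Metric.closedBall z₀ r := by
      rw [Metric.mem_closedBall]; linarith
    -- A centre that joins the maximum near `x₀` must be at distance exactly `r` from `x₀`. There
    -- the penalties differ by at least `η (r² - (r / 2)²)`, more than the error `2 δ`, and
    -- continuity spreads the strict inequality.
    have hdom : ∀ᶠ x in 𝓝 x₀, ∀ z ∈ t, z ∉ F x₀ → dist x z < r → W z x ≤ W z₀ x := by
      rw [Filter.eventually_all_finset]
      intro z hz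
      by_cases hzF : z ∈ F x₀
      · exact Filter.Eventually.of_forall fun x h => absurd hzF h
      have hge : r ≤ dist x₀ z := by
        by_contra hlt
        exact hzF (Finset.mem_filter.mpr ⟨hz, not_le.mp hlt⟩)
      rcases hge.eq_or_lt with heq | hlt
      · have hzc : x₀ ∈ Metric.closedBall z r := heq.ge
        have h1 := (abs_le.mp (hwu z hz x₀ ⟨hx₀, hzc⟩)).2
        have h2 := (abs_le.mp (hwu z₀ hz₀ x₀ ⟨hx₀, hz₀c⟩)).1
        have h3 : dist x₀ z₀ ^ 2 ≤ (r / 2) ^ 2 := by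
          exact pow_le_pow_left₀ dist_nonneg hxz₀.le 2
        have h4 : W z x₀ < W z₀ x₀ := by
          simp only [hW, ← heq]
          nlinarith [mul_le_mul_of_nonneg_left h3 hη.le]
        filter_upwards [(hWc z hz hzc).eventually_lt (hWc z₀ hz₀ hz₀c) h4] with x hx _ _
        exact hx.le
      · have hev : ∀ᶠ x in 𝓝 x₀, r < dist x z :=
          (continuous_id.dist continuous_const).continuousAt.eventually (lt_mem_nhds hlt)
        filter_upwards [hev] with x hx _ h
        exact absurd h hx.not_gt
    have hin : ∀ᶠ x in 𝓝 x₀, ∀ z ∈ F x₀, dist x z < r ∧ x ∈ Ω z := by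
      rw [Filter.eventually_all_finset]
      intro z hz
      obtain ⟨hzt, hxz⟩ := Finset.mem_filter.mp hz
      have hev : ∀ᶠ x in 𝓝 x₀, dist x z < r :=
        (continuous_id.dist continuous_const).continuousAt.eventually (gt_mem_nhds hxz)
      exact hev.and ((hΩ z hzt).mem_nhds (hXΩ z hzt ⟨hx₀, hxz.le⟩))
    obtain ⟨U, hU, hUo, hxU⟩ := eventually_nhds_iff.mp (hdom.and hin)
    refine ⟨U, hUo, hxU, ?_⟩
    have hsup : ContMSubharmonicOn m U fun x => (F x₀).sup' hJ fun z => W z x :=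
      ContMSubharmonicOn.finset_sup' hm hmn hUo hJ fun z hz =>
        (hWsub z (Finset.mem_filter.mp hz).1).mono fun x hx => ((hU x hx).2 z hz).2
    refine hsup.congr hm hmn hUo fun x hx => ?_
    obtain ⟨h1, h2⟩ := hU x hx
    have hsubset : F x₀ ⊆ F x := fun z hz =>
      Finset.mem_filter.mpr ⟨(Finset.mem_filter.mp hz).1, (h2 z hz).1⟩
    have hne : (F x).Nonempty := hJ.mono hsubset
    simp only [hv, dif_pos hne]
    refine le_antisymm (Finset.sup'_le _ _ fun z hz => ?_) (Finset.sup'_mono _ hsubset hJ)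
    by_cases hzF : z ∈ F x₀
    · exact Finset.le_sup' (fun z => W z x) hzF
    · obtain ⟨hzt, hxz⟩ := Finset.mem_filter.mp hz
      exact (h1 z hzt hzF hxz).trans (Finset.le_sup' (fun z => W z x) hz₀F)
  refine ⟨v, ?_, fun x hx => ?_⟩
  · choose! U hUo hxU hUv using hlocal
    have hopen : IsOpen (⋃ x ∈ X, U x) := isOpen_biUnion hUo
    refine ⟨⋃ x ∈ X, U x, v, hopen, fun x hx => Set.mem_biUnion hx (hxU x hx),
      contMSubharmonicOn_of_locally hm hmn (fun x hx => ?_) hopen, fun _ _ => rfl⟩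
    obtain ⟨y, hy, hxy⟩ := Set.mem_iUnion₂.mp hx
    exact ⟨U y, hUo y hy, hxy, Set.subset_biUnion_of_mem (u := U) hy, hUv y hy⟩
  · have hne := hFne x hx
    simp only [hv, dif_pos hne]
    obtain ⟨z, hz⟩ := hFne x hx
    rw [abs_le]
    constructor
    · have h1 := (abs_le.mp (hWu x hx z hz)).1
      have h2 := Finset.le_sup' (fun z => W z x) hz
      linarith
    · rw [sub_le_iff_le_add]
      refine Finset.sup'_le _ _ fun z hz => ?_
      linarith [(abs_le.mp (hWu x hx z hz)).2]

/-- Membership in `SH_m(X) ∩ C(X)` is a local property. -/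
theorem memSHInterC_of_locally (hm : 1 ≤ m) (hmn : m ≤ n) {X : Set (Cn n)} (hX : IsCompact X)
    {u : Cn n → ℝ} (h : ∀ z ∈ X, ∃ B ∈ 𝓝 z, MemSHInterC m (X ∩ closure B) u) :
    MemSHInterC m X u := by
  choose! B hB hBu using h
  have hu : ContinuousOn u X := by
    intro z hz
    have h1 := (hBu z hz).2 z ⟨hz, subset_closure (mem_of_mem_nhds (hB z hz))⟩
    rwa [continuousWithinAt_inter (Filter.mem_of_superset (hB z hz) subset_closure)] at h1
  -- A radius common to all centres; restriction then replaces the given neighbourhoods by closed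
  -- balls of radius `r`.
  obtain ⟨r₀, hr₀, hball⟩ := lebesgue_number_lemma_of_metric hX
    (c := fun z : X => interior (B z)) (fun z => isOpen_interior) fun z hz =>
      Set.mem_iUnion.mpr ⟨⟨z, hz⟩, mem_interior_iff_mem_nhds.mpr (hB z hz)⟩
  set r := r₀ / 2 with hr
  have hr0 : 0 < r := half_pos hr₀
  have hsmall : ∀ z ∈ X, MemSHInterC m (X ∩ Metric.closedBall z r) u := by
    intro z hz
    obtain ⟨y, hy⟩ := hball z hz
    refine (hBu y y.2).mono (hX.inter_right isClosed_closure)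
      (hX.inter_right Metric.isClosed_closedBall) (Set.inter_subset_inter_right _ ?_)
    exact ((Metric.closedBall_subset_ball (by linarith)).trans hy).trans
      (interior_subset.trans subset_closure)
  obtain ⟨t, htX, ht⟩ := hX.elim_nhds_subcover (fun z => Metric.ball z (r / 2))
    fun z _ => Metric.ball_mem_nhds z (by positivity)
  obtain ⟨R, hR⟩ := hX.isBounded.exists_norm_le
  set M := R ^ 2 + r ^ 2 with hMdef
  have hM0 : 0 ≤ M := by positivity
  rw [memSHInterC_iff hX]
  refine ⟨hu, fun z hz μ hμ => ?_⟩
  have hprob := hμ.1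
  have hui : Integrable u (μ.restrict X) := hu.integrableOn_compact hX
  have hmass : μ.real X = 1 := by
    rw [measureReal_def, (prob_compl_eq_zero_iff hX.measurableSet).mp hμ.2.1, ENNReal.toReal_one]
  refine le_of_forall_pos_le_add fun ε hε => ?_
  -- With `M` bounding the corrections, this gives `δ + η M ≤ ε / 2`, an error paid once at `z` and
  -- once in the integral. The second bound on `δ` ensures `2 δ < (3 / 4) η r²`.
  set η := ε / (4 * (M + 1)) with hη
  have hη0 : 0 < η := by positivity
  set δ := min (ε / 4) (η * r ^ 2 / 4) with hδ
  have hδ0 : 0 < δ := by positivity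
  have hδ1 : δ ≤ ε / 4 := min_le_left _ _
  have hδ2 : δ ≤ η * r ^ 2 / 4 := min_le_right _ _
  have hηM : η * M ≤ ε / 4 := by
    rw [hη, div_mul_eq_mul_div, div_le_div_iff₀ (by positivity) (by norm_num)]
    nlinarith
  have happ := fun z hz => (hsmall z hz).exists_uniform_approx hm hmn
    (hX.inter_right Metric.isClosed_closedBall) hδ0
  choose! Ω w hΩ hXΩ hw hwu using happ
  obtain ⟨v, hv, hvu⟩ := exists_mem_SHo_of_local_approx (m := m) (u := u) (M := M) hm hmn hr0 hη0
    (δ := δ) (t := t) (X := X) (by nlinarith [mul_pos hη0 (pow_pos hr0 2)])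
    (fun x hx => by
      obtain ⟨z, hz, hxz⟩ := Set.mem_iUnion₂.mp (ht hx)
      exact ⟨z, hz, hxz⟩)
    (fun z hz => hΩ z (htX z hz)) (fun z hz => hXΩ z (htX z hz)) (fun z hz => hw z (htX z hz))
    (fun z hz => hwu z (htX z hz)) (fun z _ x hx hxz => by
      have h1 : ‖x‖ ^ 2 ≤ R ^ 2 := pow_le_pow_left₀ (norm_nonneg x) (hR x hx) 2
      have h2 : dist x z ^ 2 ≤ r ^ 2 := pow_le_pow_left₀ dist_nonneg hxz.le 2
      rw [abs_le]
      constructor <;> nlinarith [sq_nonneg ‖x‖, sq_nonneg (dist x z)])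
  have hvi : Integrable v (μ.restrict X) :=
    ((isFunctionCone_SHo hm hmn X).continuousOn v hv).integrableOn_compact hX
  have h1 := hμ.2.2 v hv
  have h2 : ∫ x in X, v x ∂μ ≤ ∫ x in X, (u x + ε / 2) ∂μ := by
    refine setIntegral_mono_on hvi (hui.add (integrable_const _)) hX.measurableSet fun x hx => ?_
    linarith [(abs_le.mp (hvu x hx)).2]
  rw [integral_add hui (integrable_const _), setIntegral_const, hmass, one_smul] at h2
  linarith [(abs_le.mp (hvu z hz)).1]

end Compact

end MSub

end

theorem theorem2p7 (n m : ℕ) (hm : 1 ≤ m) (hmn : m ≤ n)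
    (X : Set (MSub.Cn n)) (hX : IsCompact X) (u : MSub.Cn n → ℝ) :
    MSub.MemSHInterC m X u ↔
      ∀ z ∈ X, ∃ B ∈ 𝓝 z, MSub.MemSHInterC m (X ∩ closure B) u :=
  ⟨fun h z _ => ⟨Metric.ball z 1, Metric.ball_mem_nhds z one_pos,
      h.mono hX (hX.inter_right isClosed_closure) Set.inter_subset_left⟩,
    MSub.memSHInterC_of_locally hm hmn hX⟩
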